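/- Let $T>0$, let $(\Omega,\mathcal F,(\mathcal F_t)_{t\in[0,T]},\mathbb P)$ be a filtered probability space, and let $\mathcal L^2$ be the Hilbert space of progressively measurable processes $u$ with $\mathbb E\int_0^T|u_t|^2\,dt<\infty$ (identified $dt\otimes\mathbb P$-a.e.), with $\langle u,v\rangle=\mathbb E\int_0^Tu_tv_t\,dt$. The unaffected price is $S=P+M$, where $P\in\mathcal L^2$ is a progressively measurable process with almost surely finite variation paths and $\mathbb E[P_T^2]<\infty$, and $M$ is a centered, progressively measurable, square-integrable martingale. Let $\alpha\in\mathcal L^2$ be given by $\alpha_t=\mathbb E[S_T-S_t\mid\mathcal F_t]$. Let $G:(0,\infty)\to\mathbb R$ be completely monotone ($G\in C^\infty$ and $(-1)^nG^{(n)}\ge 0$ for all $n\ge 0$) and admissible, i.e. $\sup_{t\le T}\int_0^t G(t-s)^2\,ds<\infty$, and let $\kappa_\infty\ge 0$. Let $\mathbf G$ and $\mathbf H$ be the bounded operators on $\mathcal L^2$ given by $(\mathbf Gu)_t=\int_0^tG(t-s)u_s\,ds$ and $(\mathbf Hu)_t=\kappa_\infty\int_0^tu_s\,ds$, and let $\mathbf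 H_{\phi,\varrho}$ be the integral operator $(\mathbf H_{\phi,\varrho}u)_t=\int_0^T H_{\phi,\varrho}(t,s)u_s\,ds$ with kernel $H_{\phi,\varrho}(t,s)=(\phi(T-t)+\varrho)\mathbf 1_{\{t>s\}}$; a star denotes the adjoint in $\mathcal L^2$. Let $\gamma,\phi,\varrho\ge 0$, $X_0\in\mathbb R$, and $\mathcal U(x)=ax$ with $a\ge 0$. For $u\in\mathcal L^2$ let $r^u\in\mathcal L^2$ be the solution of $r^u_t=\mathcal U\big(\mathbf G(u-r^u)_t\big)$, and put $X^u_t=X_0+\int_0^tu_s\,ds$, $I^u=\frac\gamma2u+(\mathbf H+\mathbf G)(u-r^u)$, $S^u=S+I^u$ and $$\mathcal J(u)=\mathbb E\Big[-\int_0^TS^u_tu_t\,dt+X^u_TS_T-\frac\phi2\int_0^T(X^u_t)^2\,dt-\frac\varrho2(X^u_T)^2\Big].$$ Then $r^u$ exists and is unique and $\mathcal J(u)$ is well defined for every $u\in\mathcal L^2$; $\mathbf I+a\mathbf G$ and $\mathbf I+a\mathbf G^*$ are invertible; and: 1. $(\mathbf H+\mathbf G)\circ(\mathbf I+a\mathbf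 G)^{-1}$ is positive semidefinite: $\langle u,(\mathbf H+\mathbf G)(\mathbf I+a\mathbf G)^{-1}u\rangle\ge 0$ for all $u\in\mathcal L^2$. 2. $-\mathcal J$ is $\gamma$-strongly convex on $\mathcal L^2$, i.e. $-\mathcal J-\frac\gamma2\|\cdot\|^2$ is convex. 3. $u\in\mathcal L^2$ maximizes $\mathcal J$ over $\mathcal L^2$ if and only if $$\gamma u+(\mathbf H+\mathbf G)(\mathbf I+a\mathbf G)^{-1}u+(\mathbf I+a\mathbf G^*)^{-1}(\mathbf H^*+\mathbf G^*)u+\mathbf H_{\phi,\varrho}u+\mathbf H_{\phi,\varrho}^*u=\alpha-X_0\big(\phi(T-\cdot)+\varrho\big).$$ 4. If $\gamma>0$, then $-\mathcal J$ is coercive ($-\mathcal J(u)\to+\infty$ as $\|u\|\to\infty$) and $\mathcal J$ has a unique maximizer, which by 3 is characterized by the above equation. -/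

import Mathlib

open MeasureTheory Filter Topology
open scoped ENNReal

namespace MarketResistance

/-- The time interval `[0, T]`. -/
abbrev Time (T : ℝ) : Type := Set.Icc (0 : ℝ) T

/-- Lebesgue measure on `[0, T]`. -/
noncomputable def leb (T : ℝ) : Measure (Time T) := Measure.comap Subtype.val volume

instance instIsFiniteMeasureLeb (T : ℝ) : IsFiniteMeasure (leb T) := by
  constructor
  rw [leb, comap_subtype_coe_apply measurableSet_Icc]
  exact (measure_mono (Set.image_subset_iff.2 fun x _ => x.2)).trans_lt
    (measure_Icc_lt_top (μ := (volume : Measure ℝ)) (a := 0) (b := T))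

section Resistance

variable {T : ℝ} {Ω : Type*} {mΩ : MeasurableSpace Ω}

/-- The progressive σ-algebra on `[0, T] × Ω`: the sets whose trace on `[0, t] × Ω` belongs to
`B([0, t]) ⊗ ℱ t` for every `t`. -/
@[reducible] def progSigma (ℱ : Filtration (Time T) mΩ) : MeasurableSpace (Time T × Ω) :=
  ⨅ t : Time T, MeasurableSpace.map (fun p : Set.Iic t × Ω => ((p.1 : Time T), p.2))
    (Subtype.instMeasurableSpace.prod (ℱ t))

theorem measurable_progSigma_iff (ℱ : Filtration (Time T) mΩ) (u : Time T × Ω → ℝ) :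
    Measurable[progSigma ℱ] u ↔ IsProgressive ℱ (fun t ω => u (t, ω)) := by
  constructor
  · intro h t s hs
    have := h hs
    rw [progSigma, MeasurableSpace.measurableSet_iInf] at this
    exact this t
  · intro h s hs
    rw [progSigma, MeasurableSpace.measurableSet_iInf]
    intro t
    exact h t hs

theorem progSigma_le (ℱ : Filtration (Time T) mΩ) :
    progSigma ℱ ≤ (inferInstance : MeasurableSpace (Time T × Ω)) := by
  intro A hA
  rcases isEmpty_or_nonempty (Time T) with hE | ⟨⟨t₀, h₀⟩⟩
  · have : A = ∅ := Set.eq_empty_of_forall_notMem fun p _ => hE.elim p.1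
    rw [this]; exact MeasurableSet.empty
  · rw [progSigma, MeasurableSpace.measurableSet_iInf] at hA
    have h1 := hA ⟨T, h₀.1.trans h₀.2, le_rfl⟩
    have h2 : Measurable[inferInstance, Subtype.instMeasurableSpace.prod
        (ℱ ⟨T, h₀.1.trans h₀.2, le_rfl⟩)]
        (fun p : Time T × Ω =>
          ((⟨p.1, p.1.2.2⟩ : Set.Iic (⟨T, h₀.1.trans h₀.2, le_rfl⟩ : Time T)), p.2)) := by
      refine Measurable.prodMk (measurable_fst.subtype_mk) ?_
      exact measurable_snd.mono le_rfl (ℱ.le _)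
    exact h2 h1

instance instFactProgSigmaLe (ℱ : Filtration (Time T) mΩ) :
    Fact (progSigma ℱ ≤ (inferInstance : MeasurableSpace (Time T × Ω))) := ⟨progSigma_le ℱ⟩

/-- The Hilbert space of (classes of) progressively measurable processes `u` with
`E ∫₀ᵀ |u_t|² dt < ∞`: the elements of `L²([0, T] × Ω, dt ⊗ μ)` that have a progressively measurable
representative, with the inner product `⟪u, v⟫ = E ∫₀ᵀ u_t v_t dt`. -/
abbrev ProgL2 (ℱ : Filtration (Time T) mΩ) (μ : Measure Ω) : Type _ :=
  lpMeas ℝ ℝ (progSigma ℱ) 2 ((leb T).prod μ)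

/-- A Volterra kernel is admissible if `sup_{t ≤ T} ∫₀ᵗ |K(t, s)|² ds < ∞`. Only the values
`K t s` with `s ≤ t` enter the bound and the operator below. -/
structure IsAdmissible (K : Time T → Time T → ℝ) : Prop where
  measurable : Measurable (Function.uncurry K)
  bound : ⨆ t : Time T, ∫⁻ s in Set.Iic t, ‖K t s‖ₑ ^ 2 ∂(leb T) < ∞

/-- The function `(t, ω) ↦ ∫₀ᵗ K(t, s) u_s(ω) ds`. -/
noncomputable def volterraFun (K : Time T → Time T → ℝ) (u : Time T × Ω → ℝ) (p : Time T × Ω) : ℝ :=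
  ∫ s in Set.Iic p.1, K p.1 s * u (s, p.2) ∂(leb T)

theorem measurable_volterra_aux {Ω' : Type*} [MeasurableSpace Ω'] {K : Time T → Time T → ℝ}
    (hK : Measurable (Function.uncurry K)) (i : Time T) {v : Set.Iic i × Ω' → ℝ}
    (hv : Measurable v) :
    Measurable fun p : Set.Iic i × Ω' => ∫ s, (if s ≤ (p.1 : Time T) then
      K p.1 s * v (⟨min s i, min_le_right s i⟩, p.2) else 0) ∂(leb T) := by
  have h : Measurable fun q : (Set.Iic i × Ω') × Time T => (if q.2 ≤ (q.1.1 : Time T) then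
      K q.1.1 q.2 * v (⟨min q.2 i, min_le_right q.2 i⟩, q.1.2) else 0) := by
    refine Measurable.ite ?_ ?_ measurable_const
    · exact measurableSet_le (by fun_prop) (by fun_prop)
    · refine Measurable.mul ?_ ?_
      · exact hK.comp (Measurable.prodMk (by fun_prop) measurable_snd)
      · refine hv.comp (Measurable.prodMk (Measurable.subtype_mk ?_) (by fun_prop))
        exact measurable_snd.min measurable_const
  exact (h.stronglyMeasurable.integral_prod_right').measurable

theorem measurable_volterraFun (ℱ : Filtration (Time T) mΩ) {K : Time T → Time T → ℝ}
    (hK : Measurable (Function.uncurry K)) {u : Time T × Ω → ℝ} (hu : Measurable[progSigma ℱ] u) :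
    Measurable[progSigma ℱ] (volterraFun K u) := by
  rw [measurable_progSigma_iff] at hu ⊢
  intro i
  have h := @measurable_volterra_aux T Ω (ℱ i) K hK i _ (hu i)
  have he : (fun p : Set.Iic i × Ω => volterraFun K u ((p.1 : Time T), p.2)) =
      fun p => ∫ s, (if s ≤ (p.1 : Time T) then
        K p.1 s * u (((⟨min s i, min_le_right s i⟩ : Set.Iic i) : Time T), p.2) else 0) ∂(leb T) := by
    funext p
    change ∫ s in Set.Iic (p.1 : Time T), K p.1 s * u (s, p.2) ∂(leb T) = _
    rw [← integral_indicator measurableSet_Iic]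
    refine integral_congr_ae (.of_forall fun s => ?_)
    by_cases hs : s ≤ (p.1 : Time T)
    · have h2 : min s i = s := min_eq_left (hs.trans p.1.2)
      simp [hs, h2]
    · simp [hs]
  rw [he]
  exact h

theorem volterraFun_congr {μ : Measure Ω} [SFinite μ] (K : Time T → Time T → ℝ)
    {u v : Time T × Ω → ℝ} (h : u =ᵐ[(leb T).prod μ] v) :
    volterraFun K u =ᵐ[(leb T).prod μ] volterraFun K v := by
  have h1 : ∀ᵐ ω ∂μ, ∀ᵐ s ∂(leb T), u (s, ω) = v (s, ω) := by
    have := (Measure.measurePreserving_swap (μ := μ) (ν := leb T)).quasiMeasurePreserving.ae h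
    exact Measure.ae_ae_of_ae_prod this
  filter_upwards [Measure.quasiMeasurePreserving_snd.ae h1] with p hp
  refine integral_congr_ae (ae_restrict_of_ae ?_)
  filter_upwards [hp] with s hs
  rw [hs]

theorem ae_memLp_path {μ : Measure Ω} [SFinite μ] {u : Time T × Ω → ℝ}
    (hu : MemLp u 2 ((leb T).prod μ)) :
    ∀ᵐ ω ∂μ, MemLp (fun s => u (s, ω)) 2 (leb T) := by
  have h1 := hu.integrable_sq.prod_left_ae
  have h2 : ∀ᵐ ω ∂μ, AEStronglyMeasurable (fun s => u (s, ω)) (leb T) := hu.1.prodMk_right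
  filter_upwards [h1, h2] with ω h1 h2
  exact (memLp_two_iff_integrable_sq h2).2 h1

theorem IsAdmissible.memLp {K : Time T → Time T → ℝ} (hK : IsAdmissible K) (t : Time T) :
    MemLp (K t) 2 ((leb T).restrict (Set.Iic t)) := by
  have hm : Measurable (K t) := hK.measurable.comp measurable_prodMk_left
  refine ⟨hm.aestronglyMeasurable, ?_⟩
  rw [eLpNorm_lt_top_iff_lintegral_rpow_enorm_lt_top (by norm_num) (by norm_num)]
  simpa using lt_of_le_of_lt
    (le_iSup (fun t : Time T => ∫⁻ s in Set.Iic t, ‖K t s‖ₑ ^ 2 ∂(leb T)) t) hK.bound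

theorem IsAdmissible.enorm_sq_le {K : Time T → Time T → ℝ} (hK : IsAdmissible K) (t : Time T)
    {f : Time T → ℝ} (hf : AEMeasurable f (leb T)) :
    ‖∫ s in Set.Iic t, K t s * f s ∂(leb T)‖ₑ ^ 2 ≤
      (⨆ t : Time T, ∫⁻ s in Set.Iic t, ‖K t s‖ₑ ^ 2 ∂(leb T)) * ∫⁻ s, ‖f s‖ₑ ^ 2 ∂(leb T) := by
  have hm : Measurable (K t) := hK.measurable.comp measurable_prodMk_left
  have h1 := enorm_integral_le_lintegral_enorm (μ := (leb T).restrict (Set.Iic t))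
    (fun s => K t s * f s)
  have h2 := ENNReal.lintegral_mul_le_Lp_mul_Lq ((leb T).restrict (Set.Iic t))
    Real.HolderConjugate.two_two hm.enorm.aemeasurable hf.restrict.enorm
  have h3 : ‖∫ s in Set.Iic t, K t s * f s ∂(leb T)‖ₑ ≤ _ := h1.trans (by
    simpa [enorm_mul] using h2)
  calc _ ≤ _ := pow_le_pow_left' h3 2
    _ = (∫⁻ s in Set.Iic t, ‖K t s‖ₑ ^ 2 ∂(leb T)) *
        ∫⁻ s in Set.Iic t, ‖f s‖ₑ ^ 2 ∂(leb T) := by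
      rw [mul_pow, ← ENNReal.rpow_natCast, ← ENNReal.rpow_natCast, ← ENNReal.rpow_mul,
        ← ENNReal.rpow_mul]
      norm_num
    _ ≤ _ := mul_le_mul'
      (le_iSup (fun t : Time T => ∫⁻ s in Set.Iic t, ‖K t s‖ₑ ^ 2 ∂(leb T)) t)
      (lintegral_mono' Measure.restrict_le_self le_rfl)

theorem eLpNorm_volterraFun_le {μ : Measure Ω} [SFinite μ] {K : Time T → Time T → ℝ}
    (hK : IsAdmissible K) {u : Time T × Ω → ℝ} (hu : MemLp u 2 ((leb T).prod μ))
    (hv : AEStronglyMeasurable (volterraFun K u) ((leb T).prod μ)) :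
    eLpNorm (volterraFun K u) 2 ((leb T).prod μ) ≤
      ((⨆ t : Time T, ∫⁻ s in Set.Iic t, ‖K t s‖ₑ ^ 2 ∂(leb T)) * leb T Set.univ) ^ (1 / 2 : ℝ) *
        eLpNorm u 2 ((leb T).prod μ) := by
  set C := ⨆ t : Time T, ∫⁻ s in Set.Iic t, ‖K t s‖ₑ ^ 2 ∂(leb T)
  rw [eLpNorm_eq_lintegral_rpow_enorm_toReal (by norm_num) (by norm_num),
    eLpNorm_eq_lintegral_rpow_enorm_toReal (by norm_num) (by norm_num),
    ENNReal.toReal_ofNat, ← ENNReal.mul_rpow_of_nonneg _ _ (by norm_num)]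
  refine ENNReal.rpow_le_rpow ?_ (by norm_num)
  simp only [ENNReal.rpow_ofNat]
  rw [lintegral_prod_symm _ (hv.aemeasurable.enorm.pow_const 2),
    lintegral_prod_symm _ (hu.1.aemeasurable.enorm.pow_const 2), mul_assoc]
  have h2 : ∀ᵐ ω ∂μ, AEStronglyMeasurable (fun s => u (s, ω)) (leb T) := hu.1.prodMk_right
  rw [← lintegral_const_mul'' _ (by
      exact (hu.1.aemeasurable.enorm.pow_const 2).prod_swap.lintegral_prod_right' ),
    ← lintegral_const_mul'' _ (by
      exact ((hu.1.aemeasurable.enorm.pow_const 2).prod_swap.lintegral_prod_right').const_mul _)]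
  refine lintegral_mono_ae ?_
  filter_upwards [h2] with ω hω
  calc _ ≤ ∫⁻ _ : Time T, C * ∫⁻ s, ‖u (s, ω)‖ₑ ^ 2 ∂(leb T) ∂(leb T) :=
        lintegral_mono fun t => hK.enorm_sq_le t hω.aemeasurable
    _ = _ := by rw [lintegral_const]; ring

theorem aestronglyMeasurable_volterraFun (ℱ : Filtration (Time T) mΩ) {μ : Measure Ω} [SFinite μ]
    {K : Time T → Time T → ℝ} (hK : IsAdmissible K) (u : ProgL2 ℱ μ) :
    AEStronglyMeasurable[progSigma ℱ] (volterraFun K (u : Time T × Ω → ℝ)) ((leb T).prod μ) := by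
  obtain ⟨v, hv, huv⟩ := lpMeas.aestronglyMeasurable u
  exact ⟨_, (measurable_volterraFun ℱ hK.measurable hv.measurable).stronglyMeasurable,
    volterraFun_congr K huv⟩

theorem memLp_volterraFun (ℱ : Filtration (Time T) mΩ) {μ : Measure Ω} [SFinite μ]
    {K : Time T → Time T → ℝ} (hK : IsAdmissible K) (u : ProgL2 ℱ μ) :
    MemLp (volterraFun K (u : Time T × Ω → ℝ)) 2 ((leb T).prod μ) := by
  have h := (aestronglyMeasurable_volterraFun ℱ hK u).mono (progSigma_le ℱ)
  refine ⟨h, (eLpNorm_volterraFun_le hK (Lp.memLp u.1) h).trans_lt ?_⟩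
  refine ENNReal.mul_lt_top (ENNReal.rpow_lt_top_of_nonneg (by norm_num) ?_) (Lp.memLp u.1).2
  exact (ENNReal.mul_lt_top hK.bound (measure_lt_top _ _)).ne

theorem volterraFun_add {μ : Measure Ω} [SFinite μ] {K : Time T → Time T → ℝ}
    (hK : IsAdmissible K) {u v : Time T × Ω → ℝ} (hu : MemLp u 2 ((leb T).prod μ))
    (hv : MemLp v 2 ((leb T).prod μ)) :
    volterraFun K (u + v) =ᵐ[(leb T).prod μ] volterraFun K u + volterraFun K v := by
  filter_upwards [Measure.quasiMeasurePreserving_snd.ae (ae_memLp_path hu),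
    Measure.quasiMeasurePreserving_snd.ae (ae_memLp_path hv)] with p hp hq
  simp only [volterraFun, Pi.add_apply, mul_add]
  exact integral_add ((hK.memLp p.1).integrable_mul (hp.restrict _))
    ((hK.memLp p.1).integrable_mul (hq.restrict _))

/-- The bounded operator `u ↦ ∫₀ᵗ K(t, s) u_s ds` on progressive square-integrable processes
induced by an admissible kernel `K`. -/
noncomputable def volterra (ℱ : Filtration (Time T) mΩ) (μ : Measure Ω) [SFinite μ]
    (K : Time T → Time T → ℝ) (hK : IsAdmissible K) : ProgL2 ℱ μ →L[ℝ] ProgL2 ℱ μ :=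
  LinearMap.mkContinuous
    { toFun := fun u => ⟨(memLp_volterraFun ℱ hK u).toLp (volterraFun K (u : Time T × Ω → ℝ)),
        mem_lpMeas_iff_aestronglyMeasurable.2
          ((aestronglyMeasurable_volterraFun ℱ hK u).congr (MemLp.coeFn_toLp _).symm)⟩
      map_add' := fun u v => by
        ext1; apply Lp.ext
        refine (MemLp.coeFn_toLp (memLp_volterraFun ℱ hK (u + v))).trans ?_
        refine (volterraFun_congr K (Lp.coeFn_add u.1 v.1)).trans ?_
        refine (volterraFun_add hK (Lp.memLp u.1) (Lp.memLp v.1)).trans ?_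
        refine EventuallyEq.trans ?_ (Lp.coeFn_add _ _).symm
        exact (MemLp.coeFn_toLp (memLp_volterraFun ℱ hK u)).symm.add
          (MemLp.coeFn_toLp (memLp_volterraFun ℱ hK v)).symm
      map_smul' := fun c u => by
        ext1; apply Lp.ext
        refine (MemLp.coeFn_toLp (memLp_volterraFun ℱ hK (c • u))).trans ?_
        refine (volterraFun_congr K (Lp.coeFn_smul c u.1)).trans ?_
        refine EventuallyEq.trans ?_ (Lp.coeFn_smul _ _).symm
        filter_upwards [MemLp.coeFn_toLp (memLp_volterraFun ℱ hK u)] with p hp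
        simp only [Pi.smul_apply, RingHom.id_apply, hp, smul_eq_mul]
        simp only [volterraFun, Pi.smul_apply, smul_eq_mul, mul_left_comm _ c]
        exact integral_const_mul _ _ }
    (((⨆ t : Time T, ∫⁻ s in Set.Iic t, ‖K t s‖ₑ ^ 2 ∂(leb T)) *
      leb T Set.univ) ^ (1 / 2 : ℝ)).toReal
    (fun u => by
      change ‖(memLp_volterraFun ℱ hK u).toLp _‖ ≤ _ * ‖u.1‖
      rw [Lp.norm_toLp, Lp.norm_def, ← ENNReal.toReal_mul]
      refine ENNReal.toReal_mono ?_ (eLpNorm_volterraFun_le hK (Lp.memLp u.1)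
        (memLp_volterraFun ℱ hK u).1)
      refine ENNReal.mul_ne_top (ENNReal.rpow_lt_top_of_nonneg (by norm_num) ?_).ne
        (Lp.memLp u.1).2.ne
      exact (ENNReal.mul_lt_top hK.bound (measure_lt_top _ _)).ne)

theorem isAdmissible_of_bounded {K : Time T → Time T → ℝ} (hK : Measurable (Function.uncurry K))
    (B : ℝ) (hB : ∀ t s, |K t s| ≤ B) : IsAdmissible K := by
  refine ⟨hK, lt_of_le_of_lt (iSup_le (a := ENNReal.ofReal B ^ 2 * leb T Set.univ) fun t => ?_)
    (ENNReal.mul_lt_top (by simp) (measure_lt_top _ _))⟩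
  calc _ ≤ ∫⁻ _, ENNReal.ofReal B ^ 2 ∂(leb T) := by
        refine lintegral_mono' Measure.restrict_le_self fun s => ?_
        refine pow_le_pow_left' ?_ 2
        rw [Real.enorm_eq_ofReal_abs]
        exact ENNReal.ofReal_le_ofReal (hB t s)
    _ = _ := by rw [lintegral_const]

/-- The convolution kernel `(t, s) ↦ g (t - s)` for `s < t`. -/
noncomputable def convKernel (T : ℝ) (g : ℝ → ℝ) (t s : Time T) : ℝ :=
  if s < t then g ((t : ℝ) - s) else 0

/-- The kernel `(φ (T - t) + ϱ) 1_{t > s}`. -/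
noncomputable def penaltyKernel (T φ ϱ : ℝ) (t s : Time T) : ℝ :=
  if s < t then φ * (T - t) + ϱ else 0

theorem isAdmissible_convKernel_const (T κ : ℝ) : IsAdmissible (convKernel T fun _ => κ) := by
  refine isAdmissible_of_bounded ?_ |κ| fun t s => ?_
  · exact Measurable.ite (measurableSet_lt measurable_snd measurable_fst) measurable_const
      measurable_const
  · unfold convKernel
    split_ifs <;> simp

theorem isAdmissible_penaltyKernel (T φ ϱ : ℝ) : IsAdmissible (penaltyKernel T φ ϱ) := by
  refine isAdmissible_of_bounded ?_ (|φ| * T + |ϱ|) fun t s => ?_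
  · exact Measurable.ite (measurableSet_lt measurable_snd measurable_fst) (by fun_prop)
      measurable_const
  · have hT : 0 ≤ T := t.2.1.trans t.2.2
    unfold penaltyKernel
    split_ifs
    · refine (abs_add_le _ _).trans (add_le_add ?_ le_rfl)
      rw [abs_mul, abs_of_nonneg (sub_nonneg.2 t.2.2)]
      exact mul_le_mul_of_nonneg_left (by linarith [t.2.1]) (abs_nonneg _)
    · rw [abs_zero]; positivity

/-- Complete monotonicity on `(0, ∞)`. -/
structure IsCompletelyMonotone (g : ℝ → ℝ) : Prop where
  contDiffOn : ContDiffOn ℝ ((⊤ : ℕ∞) : WithTop ℕ∞) g (Set.Ioi 0)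
  alternating : ∀ (n : ℕ) (t : ℝ), 0 < t → 0 ≤ (-1) ^ n * iteratedDeriv n g t

/-- The transient impact operator `(𝐆u)_t = ∫₀ᵗ g (t - s) u_s ds`. -/
noncomputable abbrev transientOp (ℱ : Filtration (Time T) mΩ) (μ : Measure Ω) [SFinite μ]
    (g : ℝ → ℝ) (hg : IsAdmissible (convKernel T g)) : ProgL2 ℱ μ →L[ℝ] ProgL2 ℱ μ :=
  volterra ℱ μ (convKernel T g) hg

/-- The permanent impact operator `(𝐇u)_t = κ ∫₀ᵗ u_s ds`. -/
noncomputable abbrev permanentOp (ℱ : Filtration (Time T) mΩ) (μ : Measure Ω) [SFinite μ]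
    (κ : ℝ) : ProgL2 ℱ μ →L[ℝ] ProgL2 ℱ μ :=
  volterra ℱ μ (convKernel T fun _ => κ) (isAdmissible_convKernel_const T κ)

/-- The integral operator with kernel `(φ (T - t) + ϱ) 1_{t > s}`. -/
noncomputable abbrev penaltyOp (ℱ : Filtration (Time T) mΩ) (μ : Measure Ω) [SFinite μ]
    (φ ϱ : ℝ) : ProgL2 ℱ μ →L[ℝ] ProgL2 ℱ μ :=
  volterra ℱ μ (penaltyKernel T φ ϱ) (isAdmissible_penaltyKernel T φ ϱ)

variable {ℱ : Filtration (Time T) mΩ} {μ : Measure Ω}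

/-- `r` solves the market resistance equation `r_t = U (𝐆(u - r)_t)`. -/
def IsResistance (U : ℝ → ℝ) (G : ProgL2 ℱ μ →L[ℝ] ProgL2 ℱ μ) (u r : ProgL2 ℱ μ) : Prop :=
  (r : Time T × Ω → ℝ) =ᵐ[(leb T).prod μ] fun p => U ((G (u - r) : Time T × Ω → ℝ) p)

open Classical in
/-- The market resistance `r^u`: the solution of the resistance equation (`0` if there is none). -/
noncomputable def resistance (U : ℝ → ℝ) (G : ProgL2 ℱ μ →L[ℝ] ProgL2 ℱ μ) (u : ProgL2 ℱ μ) :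
    ProgL2 ℱ μ :=
  if h : ∃ r, IsResistance U G u r then h.choose else 0

/-- The price impact `I^u = (γ / 2) u + (𝐇 + 𝐆)(u - r^u)`. -/
noncomputable def impact (U : ℝ → ℝ) (H G : ProgL2 ℱ μ →L[ℝ] ProgL2 ℱ μ) (γ : ℝ)
    (u : ProgL2 ℱ μ) : ProgL2 ℱ μ :=
  (γ / 2) • u + (H + G) (u - resistance U G u)

/-- The inventory `X^u_t = X₀ + ∫₀ᵗ u_s ds`. -/
noncomputable def inventory (X₀ : ℝ) (u : ProgL2 ℱ μ) (t : Time T) (ω : Ω) : ℝ :=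
  X₀ + ∫ s in Set.Iic t, (u : Time T × Ω → ℝ) (s, ω) ∂(leb T)

/-- The terminal time `T`, as a point of `[0, T]`. -/
def terminal (hT : 0 < T) : Time T := ⟨T, hT.le, le_rfl⟩

/-- The random variable
`-∫₀ᵀ S^u_t u_t dt + X^u_T S_T - (φ/2) ∫₀ᵀ (X^u_t)² dt - (ϱ/2) (X^u_T)²`, where `S^u = S + I^u`. -/
noncomputable def pnl (hT : 0 < T) (U : ℝ → ℝ) (H G : ProgL2 ℱ μ →L[ℝ] ProgL2 ℱ μ)
    (γ φ ϱ X₀ : ℝ) (S : Time T → Ω → ℝ) (u : ProgL2 ℱ μ) (ω : Ω) : ℝ :=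
  -(∫ t, (S t ω + (impact U H G γ u : Time T × Ω → ℝ) (t, ω)) * (u : Time T × Ω → ℝ) (t, ω) ∂(leb T))
    + inventory X₀ u (terminal hT) ω * S (terminal hT) ω
    - φ / 2 * (∫ t, inventory X₀ u t ω ^ 2 ∂(leb T))
    - ϱ / 2 * inventory X₀ u (terminal hT) ω ^ 2

/-- The performance functional `J(u) = E[pnl u]`. -/
noncomputable def performance (hT : 0 < T) (U : ℝ → ℝ) (H G : ProgL2 ℱ μ →L[ℝ] ProgL2 ℱ μ)
    (γ φ ϱ X₀ : ℝ) (S : Time T → Ω → ℝ) (u : ProgL2 ℱ μ) : ℝ :=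
  ∫ ω, pnl hT U H G γ φ ϱ X₀ S u ω ∂μ

/-- All the integrals in the definition of `performance` at `u` converge. -/
def PerformanceWellDefined (hT : 0 < T) (U : ℝ → ℝ) (H G : ProgL2 ℱ μ →L[ℝ] ProgL2 ℱ μ)
    (γ φ ϱ X₀ : ℝ) (S : Time T → Ω → ℝ) (u : ProgL2 ℱ μ) : Prop :=
  (∀ᵐ ω ∂μ,
    Integrable (fun t => (u : Time T × Ω → ℝ) (t, ω)) (leb T) ∧
    Integrable (fun t => (S t ω + (impact U H G γ u : Time T × Ω → ℝ) (t, ω)) *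
      (u : Time T × Ω → ℝ) (t, ω)) (leb T) ∧
    Integrable (fun t => inventory X₀ u t ω ^ 2) (leb T)) ∧
  Integrable (pnl hT U H G γ φ ϱ X₀ S u) μ

/-- `α` is (the class of a progressive version of) the signal `α_t = E[S_T - S_t | ℱ_t]`. -/
def IsAlphaSignal (hT : 0 < T) (S : Time T → Ω → ℝ) (α : ProgL2 ℱ μ) : Prop :=
  ∀ᵐ t ∂(leb T), (fun ω => (α : Time T × Ω → ℝ) (t, ω)) =ᵐ[μ] μ[S (terminal hT) - S t | ℱ t]

/-- The first-order condition
`γ u + (𝐇 + 𝐆)(𝐈 + a𝐆)⁻¹ u + (𝐈 + a𝐆*)⁻¹ (𝐇* + 𝐆*) u + 𝐍 u + 𝐍* u = α - X₀ (φ (T - ·) + ϱ)`,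
as an equality of processes (`dt ⊗ μ`-almost everywhere), where `𝐍` is the last operator argument. -/
def FirstOrderCondition (a γ φ ϱ X₀ : ℝ) (H G N : ProgL2 ℱ μ →L[ℝ] ProgL2 ℱ μ)
    (α u : ProgL2 ℱ μ) : Prop :=
  ((γ • u
    + ((H + G) * Ring.inverse (1 + a • G)) u
    + (Ring.inverse (1 + a • ContinuousLinearMap.adjoint G) *
        (ContinuousLinearMap.adjoint H + ContinuousLinearMap.adjoint G)) u
    + N u + ContinuousLinearMap.adjoint N u : ProgL2 ℱ μ) : Time T × Ω → ℝ)
  =ᵐ[(leb T).prod μ]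
    fun p => (α : Time T × Ω → ℝ) p - X₀ * (φ * (T - p.1) + ϱ)

end Resistance
end MarketResistance

open MarketResistance

/-! For linear resistance the equation for `r` reads `v + a G v = u` with `v = u - r`, so `u - r =
(1 + a G)⁻¹ u`. The performance then becomes `c + ⟪α - D, u⟫ - (γ/2) ‖u‖² - ⟪u, B u⟫`, where `B = (H
+ G)(1 + a G)⁻¹ + N`, `N` is the penalty operator and `D = X₀ (φ (T - ·) + ϱ)`. Once `B ≥ 0`, the
first-order condition, strong convexity, coercivity and the unique maximizer are general facts about
quadratic functionals on a Hilbert space.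

Positivity of the impact part rests on the expansion `⟪u, (H + G) v⟫ = ⟪v, H v⟫ + ⟪v, G v⟫ + a ⟪G v,
H v⟫ + a ‖G v‖²` (`inner_mul_inverse_nonneg`). The first three terms are handled path by path, using
only `g ≥ 0`, `g' ≤ 0`, `g'' ≥ 0`. A convex nonincreasing kernel is a nonnegative mixture of a
constant and tents `(θ - ·)⁺`, and tents are positive definite as autocorrelations of indicators
(`integral_convKernel_nonneg`). In the cross term `H v` is `κ` times the primitive `V` of `v`. A
nonincreasing kernel is a mixture of a constant and indicators of `(0, θ)`, for which the impact is
`V(t) - V(t - θ)`, and `∫ V (V - V(· - θ)) ≥ 0` because the shift does not increase the `L²` norm on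
`[0, T]` (`integral_convKernel_mul_primitive_nonneg`).

The price enters through `α` alone: a progressive control can be pulled out of the conditional
expectation of the increment up to `T` (`integral_increment_mul_eq_inner`). -/

namespace MarketResistance

/-! ### Concave quadratic functionals on a Hilbert space. -/

section Hilbert

variable {E : Type*} [NormedAddCommGroup E] [InnerProductSpace ℝ E]

/-- A bounded operator that dominates the identity in the sense of quadratic forms is invertible. -/
theorem isUnit_of_sq_norm_le_inner [CompleteSpace E] (A : E →L[ℝ] E) {c : ℝ} (hc : 0 < c)
    (hA : ∀ u, c * ‖u‖ ^ 2 ≤ inner ℝ u (A u)) : IsUnit A := by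
  refine ContinuousLinearMap.isUnit_of_forall_le_norm_inner_map A (c := ⟨c, hc.le⟩) hc fun u => ?_
  rw [real_inner_comm, Real.norm_eq_abs]
  refine le_trans (le_of_eq ?_) ((hA u).trans (le_abs_self _))
  change ‖u‖ ^ 2 * c = _
  ring

theorem isUnit_one_add_of_inner_nonneg [CompleteSpace E] (A : E →L[ℝ] E)
    (hA : ∀ u, 0 ≤ inner ℝ u (A u)) : IsUnit (1 + A) := by
  refine isUnit_of_sq_norm_le_inner _ one_pos fun u => ?_
  simp only [add_apply, one_apply_eq_self, inner_add_right,
    real_inner_self_eq_norm_sq]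
  linarith [hA u]

/-- The concave quadratic functional `c + ⟪b, u⟫ - (γ / 2) ‖u‖² - ⟪u, B u⟫`. -/
noncomputable def quadratic (c γ : ℝ) (b : E) (B : E →L[ℝ] E) (u : E) : ℝ :=
  c + inner ℝ b u - γ / 2 * ‖u‖ ^ 2 - inner ℝ u (B u)

variable {c γ : ℝ} {b : E} {B : E →L[ℝ] E}

/-- The exact second-order expansion: the vector paired with `h` is the gradient at `u`, and its
vanishing is the first-order condition. -/
theorem quadratic_add [CompleteSpace E] (u h : E) : quadratic c γ b B (u + h) =
    quadratic c γ b B u + inner ℝ (b - (γ • u + B u + ContinuousLinearMap.adjoint B u)) h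
      - γ / 2 * ‖h‖ ^ 2 - inner ℝ h (B h) := by
  simp only [quadratic, map_add, inner_add_left, inner_add_right, inner_sub_left,
    ContinuousLinearMap.adjoint_inner_left, ← real_inner_self_eq_norm_sq, inner_smul_left,
    conj_trivial, real_inner_comm h u, real_inner_comm h (B u)]
  ring

theorem forall_quadratic_le_iff [CompleteSpace E] (hγ : 0 ≤ γ) (hB : ∀ u, 0 ≤ inner ℝ u (B u))
    (u : E) : (∀ v, quadratic c γ b B v ≤ quadratic c γ b B u) ↔
      γ • u + B u + ContinuousLinearMap.adjoint B u = b := by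
  constructor
  · intro h
    set w := b - (γ • u + B u + ContinuousLinearMap.adjoint B u) with hw
    suffices h0 : w = 0 from (sub_eq_zero.1 (hw ▸ h0)).symm
    set C := γ / 2 * ‖w‖ ^ 2 + inner ℝ w (B w) with hC
    have hC0 : 0 ≤ C := by have := hB w; positivity
    -- Perturbing along the gradient `w`, the first-order gain cannot exceed the second-order loss
    -- `ε² C`.
    have key : ∀ ε : ℝ, ε * ‖w‖ ^ 2 ≤ ε ^ 2 * C := by
      intro ε
      have h1 := h (u + ε • w)
      rw [quadratic_add, ← hw] at h1
      simp only [map_smul, inner_smul_left, inner_smul_right, norm_smul, mul_pow,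
        real_inner_self_eq_norm_sq, conj_trivial, Real.norm_eq_abs, sq_abs] at h1
      rw [hC]; nlinarith
    -- This `ε` makes `ε C ≤ ‖w‖² / 2`, against `‖w‖² ≤ ε C` from `key` when `w ≠ 0`; `C + 1` avoids
    -- dividing by zero.
    have h2 := key (‖w‖ ^ 2 / (C + 1) / 2)
    have h3 : ‖w‖ ^ 2 = 0 := by
      by_contra hne
      have hpos : 0 < ‖w‖ ^ 2 := lt_of_le_of_ne (sq_nonneg _) (Ne.symm hne)
      have hε : 0 < ‖w‖ ^ 2 / (C + 1) / 2 := by positivity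
      have h4 : ‖w‖ ^ 2 ≤ ‖w‖ ^ 2 / (C + 1) / 2 * C := by nlinarith
      have h5 : ‖w‖ ^ 2 / (C + 1) * C ≤ ‖w‖ ^ 2 := by
        rw [div_mul_eq_mul_div, div_le_iff₀ (by positivity)]; nlinarith
      nlinarith
    simpa using h3
  · intro h v
    have h1 := quadratic_add (c := c) (γ := γ) (b := b) (B := B) u (v - u)
    rw [h, sub_self, inner_zero_left, add_sub_cancel] at h1
    have := hB (v - u)
    have : 0 ≤ γ / 2 * ‖v - u‖ ^ 2 := by positivity
    linarith

theorem strongConvexOn_neg_quadratic (hB : ∀ u, 0 ≤ inner ℝ u (B u)) :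
    StrongConvexOn Set.univ γ fun u => -quadratic c γ b B u := by
  rw [strongConvexOn_iff_convex]
  refine ⟨convex_univ, fun x _ y _ s t hs ht hst => ?_⟩
  -- With the `γ` term removed, the convexity gap is exactly `s t ⟪x - y, B (x - y)⟫`.
  have h := mul_nonneg (mul_nonneg hs ht) (hB (x - y))
  obtain rfl : t = 1 - s := by linarith
  simp only [quadratic, map_add, map_sub, map_smul, inner_add_left, inner_add_right,
    inner_sub_left, inner_sub_right, inner_smul_left, inner_smul_right, conj_trivial,
    smul_eq_mul] at h ⊢
  nlinarith

theorem tendsto_neg_quadratic (hγ : 0 < γ) (hB : ∀ u, 0 ≤ inner ℝ u (B u)) :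
    Tendsto (fun u => -quadratic c γ b B u) (Bornology.cobounded E) atTop := by
  have h1 : Tendsto (fun x : ℝ => x * (γ / 2 * x - ‖b‖) - c) atTop atTop := by
    refine tendsto_atTop_add_const_right _ _ (tendsto_id.atTop_mul_atTop₀ ?_)
    exact tendsto_atTop_add_const_right _ _ (tendsto_id.const_mul_atTop (by positivity))
  refine tendsto_atTop_mono (fun u => ?_) (h1.comp tendsto_norm_cobounded_atTop)
  have := real_inner_le_norm b u
  have := hB u
  simp only [quadratic, Function.comp_apply]
  nlinarith

/-- Maximizers are the solutions of a linear equation whose operator `γ + B + B*` is coercive, since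
`B*` has the same quadratic form as `B`. Its bijectivity gives existence and uniqueness together. -/
theorem existsUnique_forall_quadratic_le [CompleteSpace E] (hγ : 0 < γ)
    (hB : ∀ u, 0 ≤ inner ℝ u (B u)) :
    ∃! u, ∀ v, quadratic c γ b B v ≤ quadratic c γ b B u := by
  simp only [forall_quadratic_le_iff hγ.le hB]
  have hu : IsUnit (γ • (1 : E →L[ℝ] E) + B + ContinuousLinearMap.adjoint B) := by
    refine isUnit_of_sq_norm_le_inner _ hγ fun u => ?_
    simp only [add_apply, smul_apply,
      one_apply_eq_self, inner_add_right, inner_smul_right,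
      real_inner_self_eq_norm_sq, ContinuousLinearMap.adjoint_inner_right]
    have := hB u
    have h2 := hB u
    rw [real_inner_comm] at h2
    linarith
  have := (ContinuousLinearMap.isUnit_iff_bijective.1 hu).existsUnique b
  simpa using this

end Hilbert

/-! ### Mixtures of kernels, and integrals over a triangle. -/

section Mixture

theorem integrable_ite_zero {E : Type*} [MeasurableSpace E] {ρ : Measure E} {q : E → Prop}
    [DecidablePred q] (hq : MeasurableSet {p | q p}) {h : E → ℝ} (hi : Integrable h ρ) :
    Integrable (fun p => if q p then h p else 0) ρ := by
  refine (hi.indicator hq).congr (.of_forall fun p => ?_)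
  simp [Set.indicator_apply]

/-- A mixture, with nonnegative weights, of kernels with nonnegative integral against `w`
has nonnegative integral against `w`. -/
theorem integral_mixture_mul_nonneg {Θ E : Type*} [MeasurableSpace Θ] [MeasurableSpace E]
    {ν : Measure Θ} {ρ : Measure E} [SFinite ν] [SFinite ρ] {k : Θ → E → ℝ} {w : E → ℝ}
    (hk : Measurable (Function.uncurry k)) (hk0 : ∀ᵐ θ ∂ν, ∀ p, 0 ≤ k θ p)
    (hki : ∀ p, Integrable (fun θ => k θ p) ν) (hw : AEStronglyMeasurable w ρ)
    (hi : Integrable (fun p => (∫ θ, k θ p ∂ν) * w p) ρ)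
    (hpos : ∀ᵐ θ ∂ν, 0 ≤ ∫ p, k θ p * w p ∂ρ) :
    0 ≤ ∫ p, (∫ θ, k θ p ∂ν) * w p ∂ρ := by
  -- The weights being nonnegative, integrating `|k w|` over `θ` returns the absolute value of the
  -- mixed kernel times `w`. Hence `hi` alone justifies Fubini, even for kernels singular on the
  -- diagonal.
  have hint : Integrable (fun q : E × Θ => k q.2 q.1 * w q.1) (ρ.prod ν) := by
    rw [integrable_prod_iff]
    · refine ⟨.of_forall fun p => (hki p).mul_const (w p), hi.norm.congr (.of_forall fun p => ?_)⟩
      simp only [norm_mul, integral_mul_const]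
      rw [Real.norm_of_nonneg (integral_nonneg_of_ae (hk0.mono fun θ h => h p))]
      congr 1
      exact integral_congr_ae (hk0.mono fun θ h => (Real.norm_of_nonneg (h p)).symm)
    · exact (hk.comp measurable_swap).aestronglyMeasurable.mul hw.comp_fst
  calc 0 ≤ ∫ θ, ∫ p, k θ p * w p ∂ρ ∂ν := integral_nonneg_of_ae hpos
    _ = ∫ p, ∫ θ, k θ p * w p ∂ν ∂ρ := (integral_integral_swap hint).symm
    _ = _ := by simp only [integral_mul_const]

/-- The integral of a symmetric function over the triangle above the diagonal is half of the
integral over the square. -/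
theorem integral_triangle_of_symm {E : Type*} [LinearOrder E] [TopologicalSpace E]
    [OrderClosedTopology E] [SecondCountableTopology E] [MeasurableSpace E] [BorelSpace E]
    {ρ : Measure E} [SFinite ρ] [NullSingletonClass ρ] {h : E × E → ℝ} (hi : Integrable h (ρ.prod ρ))
    (hs : ∀ p, h p.swap = h p) :
    ∫ p, (if p.2 < p.1 then h p else 0) ∂(ρ.prod ρ) = 1 / 2 * ∫ p, h p ∂(ρ.prod ρ) := by
  have hm : MeasurableSet {p : E × E | p.2 < p.1} := measurableSet_lt measurable_snd measurable_fst
  have hm' : MeasurableSet {p : E × E | p.1 < p.2} := measurableSet_lt measurable_fst measurable_snd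
  have i1 : Integrable (fun p : E × E => if p.2 < p.1 then h p else 0) (ρ.prod ρ) :=
    integrable_ite_zero hm hi
  have i2 : Integrable (fun p : E × E => if p.1 < p.2 then h p else 0) (ρ.prod ρ) :=
    integrable_ite_zero hm' hi
  have e1 : ∫ p, (if p.2 < p.1 then h p else 0) ∂(ρ.prod ρ) =
      ∫ p, (if p.1 < p.2 then h p else 0) ∂(ρ.prod ρ) := by
    rw [← integral_prod_swap]
    simp only [Prod.fst_swap, Prod.snd_swap, hs]
  have hd : ∀ᵐ p ∂(ρ.prod ρ), p.1 ≠ p.2 := by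
    refine Measure.ae_prod_iff_ae_ae ?_ |>.2 (.of_forall fun x => ?_)
    · exact (measurableSet_eq_fun measurable_fst measurable_snd).compl
    · filter_upwards [Measure.ae_ne ρ x] with y hy using Ne.symm hy
  have e2 : ∫ p, h p ∂(ρ.prod ρ) = ∫ p, (if p.2 < p.1 then h p else 0) ∂(ρ.prod ρ) +
      ∫ p, (if p.1 < p.2 then h p else 0) ∂(ρ.prod ρ) := by
    rw [← integral_add i1 i2]
    refine integral_congr_ae ?_
    filter_upwards [hd] with p hp
    rcases lt_or_gt_of_ne hp with h1 | h1 <;> simp [h1, h1.not_gt]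
  linarith

end Mixture

/-! ### Volterra forms and primitives along a single path. -/

section Paths

variable {T : ℝ}

instance instNullSingletonClassLeb (T : ℝ) : NullSingletonClass (leb T) := by
  constructor
  intro x
  rw [leb, comap_subtype_coe_apply measurableSet_Icc, Set.image_singleton, measure_singleton]

theorem integral_leb (T : ℝ) (F : ℝ → ℝ) :
    ∫ t, F t ∂(leb T) = ∫ t in Set.Icc 0 T, F t :=
  integral_subtype_comap measurableSet_Icc F

theorem leb_real_Ici (r : Time T) : (leb T).real (Set.Ici r) = T - r := by
  have h : Subtype.val '' Set.Ici r = Set.Icc (r : ℝ) T := by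
    ext x
    constructor
    · rintro ⟨t, ht, rfl⟩
      exact ⟨ht, t.2.2⟩
    · intro hx
      exact ⟨⟨x, r.2.1.trans hx.1, hx.2⟩, hx.1, rfl⟩
  rw [measureReal_def, leb, comap_subtype_coe_apply measurableSet_Icc, h, Real.volume_Icc,
    ENNReal.toReal_ofReal (sub_nonneg.2 r.2.2)]

/-- A kernel that vanishes on and above the diagonal. -/
def IsCausal (K : Time T → Time T → ℝ) : Prop := ∀ t s, ¬ s < t → K t s = 0

theorem isCausal_convKernel (g : ℝ → ℝ) : IsCausal (convKernel T g) := fun _ _ h => if_neg h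

theorem isCausal_penaltyKernel (φ ϱ : ℝ) : IsCausal (penaltyKernel T φ ϱ) := fun _ _ h => if_neg h

variable {K : Time T → Time T → ℝ}

theorem IsCausal.setIntegral_Iic (hc : IsCausal K) (f : Time T → ℝ) (t : Time T) :
    ∫ s in Set.Iic t, K t s * f s ∂(leb T) = ∫ s, K t s * f s ∂(leb T) := by
  refine setIntegral_eq_integral_of_forall_compl_eq_zero fun s hs => ?_
  rw [hc t s fun h => hs h.le, zero_mul]

/-- Causality makes the admissibility bound on `[0, t]` a bound for the whole row `K t`, uniformly
in `t`, and `[0, T]` has finite length. The kernel is thus Hilbert–Schmidt and pairs with products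
of `L²` paths. -/
theorem IsAdmissible.memLp_uncurry (hK : IsAdmissible K) (hc : IsCausal K) :
    MemLp (Function.uncurry K) 2 ((leb T).prod (leb T)) := by
  refine ⟨hK.measurable.aestronglyMeasurable, ?_⟩
  rw [eLpNorm_lt_top_iff_lintegral_rpow_enorm_lt_top (by norm_num) (by norm_num)]
  simp only [ENNReal.toReal_ofNat, ENNReal.rpow_ofNat]
  rw [lintegral_prod _ (by exact (hK.measurable.enorm.pow_const 2).aemeasurable)]
  refine lt_of_le_of_lt (lintegral_mono fun t => ?_) (lintegral_const_lt_top hK.bound.ne)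
  refine le_trans (le_of_eq ?_)
    (le_iSup (fun t : Time T => ∫⁻ s in Set.Iic t, ‖K t s‖ₑ ^ 2 ∂(leb T)) t)
  rw [← lintegral_indicator measurableSet_Iic]
  refine lintegral_congr fun s => ?_
  by_cases hs : s ≤ t
  · simp [hs]
  · simp [hs, hc t s fun h => hs h.le]

theorem memLp_mul_prod {w f : Time T → ℝ} (hw : MemLp w 2 (leb T)) (hf : MemLp f 2 (leb T)) :
    MemLp (fun p : Time T × Time T => w p.1 * f p.2) 2 ((leb T).prod (leb T)) := by
  refine (memLp_two_iff_integrable_sq (hw.1.comp_fst.mul hf.1.comp_snd)).2 ?_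
  simp only [Pi.mul_apply, mul_pow]
  exact hw.integrable_sq.mul_prod hf.integrable_sq

theorem IsAdmissible.integrable_mul (hK : IsAdmissible K) (hc : IsCausal K) {w f : Time T → ℝ}
    (hw : MemLp w 2 (leb T)) (hf : MemLp f 2 (leb T)) :
    Integrable (fun p : Time T × Time T => K p.1 p.2 * (w p.1 * f p.2))
      ((leb T).prod (leb T)) :=
  (hK.memLp_uncurry hc).integrable_mul (memLp_mul_prod hw hf)

/-- The bilinear form of a Volterra operator, as an integral over the square. -/
theorem IsAdmissible.integral_mul_volterra (hK : IsAdmissible K) (hc : IsCausal K)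
    {w f : Time T → ℝ} (hw : MemLp w 2 (leb T)) (hf : MemLp f 2 (leb T)) :
    ∫ t, w t * ∫ s in Set.Iic t, K t s * f s ∂(leb T) ∂(leb T) =
      ∫ p, K p.1 p.2 * (w p.1 * f p.2) ∂((leb T).prod (leb T)) := by
  rw [integral_prod _ (hK.integrable_mul hc hw hf)]
  refine integral_congr_ae (.of_forall fun t => ?_)
  simp only [hc.setIntegral_Iic]
  rw [← integral_const_mul]
  refine integral_congr_ae (.of_forall fun s => ?_)
  simp only
  ring

/-- `x ↦ ∫₀ˣ f`, extended by `0` to the left of `0`. -/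
noncomputable def primitive (f : Time T → ℝ) (x : ℝ) : ℝ :=
  ∫ s, (if (s : ℝ) ≤ x then f s else 0) ∂(leb T)

theorem primitive_coe (f : Time T → ℝ) (t : Time T) :
    primitive f t = ∫ s in Set.Iic t, f s ∂(leb T) := by
  rw [← integral_indicator measurableSet_Iic]
  rfl

theorem primitive_of_neg (f : Time T → ℝ) {x : ℝ} (hx : x < 0) : primitive f x = 0 := by
  have : ∀ s : Time T, ¬ (s : ℝ) ≤ x := fun s hs => (s.2.1.trans hs).not_gt hx
  simp [primitive, this]

theorem primitive_of_ge (f : Time T → ℝ) {x : ℝ} (hx : T ≤ x) :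
    primitive f x = ∫ s, f s ∂(leb T) := by
  have : ∀ s : Time T, (s : ℝ) ≤ x := fun s => s.2.2.trans hx
  simp [primitive, this]

theorem integrable_ite_le {f : Time T → ℝ} (hf : Integrable f (leb T)) (x : ℝ) :
    Integrable (fun s : Time T => if (s : ℝ) ≤ x then f s else 0) (leb T) :=
  integrable_ite_zero (measurableSet_le measurable_subtype_coe measurable_const) hf

theorem measurable_primitive {f : Time T → ℝ} (hf : AEStronglyMeasurable f (leb T)) :
    Measurable (primitive f) := by
  -- The primitive depends only on the class of `f`, so the measurable representative gives the same
  -- function at every point.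
  have he : primitive f = primitive (hf.mk f) := by
    funext x
    refine integral_congr_ae ?_
    filter_upwards [hf.ae_eq_mk] with s hs
    rw [hs]
  rw [he]
  have h : Measurable fun q : ℝ × Time T => if (q.2 : ℝ) ≤ q.1 then hf.mk f q.2 else 0 :=
    Measurable.ite (measurableSet_le (by fun_prop) (by fun_prop))
      (hf.stronglyMeasurable_mk.measurable.comp measurable_snd) measurable_const
  exact h.stronglyMeasurable.integral_prod_right'.measurable

theorem abs_primitive_le {f : Time T → ℝ} (hf : Integrable f (leb T)) (x : ℝ) :
    |primitive f x| ≤ ∫ s, |f s| ∂(leb T) := by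
  refine (abs_integral_le_integral_abs).trans (integral_mono (integrable_ite_le hf x).abs hf.abs ?_)
  intro s
  simp only
  split_ifs
  · exact le_rfl
  · simp

theorem memLp_primitive {f : Time T → ℝ} (hf : Integrable f (leb T)) :
    MemLp (fun t : Time T => primitive f t) 2 (leb T) :=
  MemLp.of_bound ((measurable_primitive hf.1).comp measurable_subtype_coe).aestronglyMeasurable
    _ (.of_forall fun t => abs_primitive_le hf t)

theorem memLp_primitive_shift {f : Time T → ℝ} (hf : Integrable f (leb T)) (θ : ℝ) :
    MemLp (fun t : Time T => primitive f (t - θ)) 2 (leb T) :=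
  MemLp.of_bound ((measurable_primitive hf.1).comp
    (measurable_subtype_coe.sub_const θ)).aestronglyMeasurable
    _ (.of_forall fun _ => abs_primitive_le hf _)

/-- Identifies the impact of the kernel `1_{(0, θ)}` with an increment of the primitive; the
endpoint `s = t` is a null set. -/
theorem primitive_sub_primitive {f : Time T → ℝ} (hf : Integrable f (leb T)) {θ : ℝ} (hθ : 0 < θ)
    (t : Time T) : primitive f t - primitive f (t - θ) =
      ∫ s, (if s < t ∧ (t : ℝ) - s < θ then f s else 0) ∂(leb T) := by
  rw [primitive, primitive, ← integral_sub (integrable_ite_le hf _) (integrable_ite_le hf _)]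
  refine integral_congr_ae ?_
  filter_upwards [Measure.ae_ne (leb T) t] with s hs
  have h1 : s < t ↔ (s : ℝ) ≤ t := ⟨fun h => h.le, fun h => lt_of_le_of_ne h hs⟩
  simp only [h1]
  by_cases h2 : (s : ℝ) ≤ t
  · by_cases h3 : (s : ℝ) ≤ t - θ
    · have : ¬ ((t : ℝ) - s < θ) := by linarith
      simp [h2, h3, this]
    · have : (t : ℝ) - s < θ := by linarith
      simp [h2, h3, this]
  · have h3 : ¬ (s : ℝ) ≤ t - θ := by linarith
    simp [h2, h3]

/-- The primitive vanishes to the left of `0`, so shifting it right by `θ` only pushes mass out of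
`[0, T]`. Truncating to `[0, T]` inside `ℝ` makes translation invariance available. -/
theorem integral_sq_primitive_shift_le {f : Time T → ℝ} (hf : Integrable f (leb T)) {θ : ℝ}
    (hθ : 0 < θ) :
    ∫ t : Time T, primitive f (t - θ) ^ 2 ∂(leb T) ≤ ∫ t : Time T, primitive f t ^ 2 ∂(leb T) := by
  set W : ℝ → ℝ := (Set.Icc 0 T).indicator fun x => primitive f x ^ 2 with hW
  have hb : ∀ x, primitive f x ^ 2 ≤ (∫ s, |f s| ∂(leb T)) ^ 2 := fun x =>
    sq_le_sq' (abs_le.1 (abs_primitive_le hf x)).1 (abs_le.1 (abs_primitive_le hf x)).2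
  have hm : Measurable fun x => primitive f x ^ 2 := (measurable_primitive hf.1).pow_const 2
  have hWi : Integrable W := by
    refine (integrable_indicator_iff measurableSet_Icc).2 ?_
    refine Measure.integrableOn_of_bounded (M := (∫ s, |f s| ∂(leb T)) ^ 2)
      measure_Icc_lt_top.ne hm.aestronglyMeasurable (.of_forall fun x => ?_)
    rw [Real.norm_of_nonneg (sq_nonneg _)]
    exact hb x
  rw [integral_leb T fun x => primitive f (x - θ) ^ 2, integral_leb T fun x => primitive f x ^ 2,
    ← integral_indicator measurableSet_Icc, ← integral_indicator measurableSet_Icc, ← hW,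
    ← integral_sub_right_eq_self W θ]
  refine integral_mono_of_nonneg (.of_forall fun x => Set.indicator_nonneg
    (fun _ _ => sq_nonneg _) x) (hWi.comp_sub_right θ) (.of_forall fun x => ?_)
  by_cases hx : x ∈ Set.Icc 0 T
  · simp only [hx, Set.indicator_of_mem]
    by_cases h0 : 0 ≤ x - θ
    · rw [hW, Set.indicator_of_mem (show x - θ ∈ Set.Icc 0 T from ⟨h0, by linarith [hx.2]⟩)]
    · rw [primitive_of_neg f (not_le.1 h0)]
      simpa using Set.indicator_nonneg (fun _ _ => sq_nonneg _) (x - θ)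
  · rw [Set.indicator_of_notMem hx]
    exact Set.indicator_nonneg (fun _ _ => sq_nonneg _) _

/-- From `x (x - y) = (x² - y² + (x - y)²) / 2` and the loss of mass under the shift. -/
theorem integral_primitive_mul_sub_nonneg {f : Time T → ℝ} (hf : Integrable f (leb T)) {θ : ℝ}
    (hθ : 0 < θ) :
    0 ≤ ∫ t : Time T, primitive f t * (primitive f t - primitive f (t - θ)) ∂(leb T) := by
  have h1 := (memLp_primitive hf).integrable_sq
  have h2 := (memLp_primitive_shift hf θ).integrable_sq
  have h3 : Integrable (fun t : Time T => (primitive f t - primitive f (t - θ)) ^ 2) (leb T) :=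
    ((memLp_primitive hf).sub (memLp_primitive_shift hf θ)).integrable_sq
  have h12 : Integrable (fun t : Time T => primitive f t ^ 2 - primitive f (t - θ) ^ 2) (leb T) :=
    h1.sub h2
  have e : ∫ t : Time T, primitive f t * (primitive f t - primitive f (t - θ)) ∂(leb T) =
      1 / 2 * (∫ t : Time T, primitive f t ^ 2 ∂(leb T) -
        ∫ t : Time T, primitive f (t - θ) ^ 2 ∂(leb T) +
        ∫ t : Time T, (primitive f t - primitive f (t - θ)) ^ 2 ∂(leb T)) := by
    rw [← integral_sub h1 h2, ← integral_add h12 h3, ← integral_const_mul]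
    refine integral_congr_ae (.of_forall fun t => ?_)
    ring
  have h4 := integral_sq_primitive_shift_le hf hθ
  have h5 : 0 ≤ ∫ t : Time T, (primitive f t - primitive f (t - θ)) ^ 2 ∂(leb T) :=
    integral_nonneg fun _ => sq_nonneg _
  rw [e]
  linarith

/-- Fubini for integration up to a time `t`, integrated over `t`. -/
theorem integral_integral_ite_le {E : Type*} [MeasurableSpace E] {ρ : Measure E} [SFinite ρ]
    {h : E → ℝ} {r : E → Time T} (hh : Integrable h ρ) (hr : Measurable r) :
    ∫ t, ∫ p, (if r p ≤ t then h p else 0) ∂ρ ∂(leb T) = ∫ p, (T - r p) * h p ∂ρ := by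
  have hi : Integrable (fun q : Time T × E => if r q.2 ≤ q.1 then h q.2 else 0) ((leb T).prod ρ) :=
    integrable_ite_zero (measurableSet_le (hr.comp measurable_snd) measurable_fst)
      (hh.comp_snd (leb T))
  rw [integral_integral_swap hi]
  refine integral_congr_ae (.of_forall fun p => ?_)
  simp only
  rw [← leb_real_Ici (r p), ← smul_eq_mul, ← setIntegral_const,
    ← integral_indicator measurableSet_Ici]
  rfl

/-- Source of the weight `φ (T - t)`: it turns the part of the running penalty linear in `X₀` into a
pairing with the control. -/
theorem integral_primitive {f : Time T → ℝ} (hf : Integrable f (leb T)) :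
    ∫ t : Time T, primitive f t ∂(leb T) = ∫ t : Time T, (T - t) * f t ∂(leb T) :=
  integral_integral_ite_le hf measurable_id

theorem sq_integral_eq {f : Time T → ℝ} (hf : Integrable f (leb T)) :
    ∫ p, (if p.2 < p.1 then f p.1 * f p.2 else 0) ∂((leb T).prod (leb T)) =
      1 / 2 * (∫ s, f s ∂(leb T)) ^ 2 := by
  rw [integral_triangle_of_symm (hf.mul_prod hf) fun p => mul_comm _ _, integral_prod_mul, sq]

/-- The bilinear form of the penalty operator is the running and terminal inventory penalty. -/
theorem integral_penaltyKernel (φ ϱ : ℝ) {f : Time T → ℝ} (hf : MemLp f 2 (leb T)) :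
    ∫ p, penaltyKernel T φ ϱ p.1 p.2 * (f p.1 * f p.2) ∂((leb T).prod (leb T)) =
      φ / 2 * ∫ t : Time T, primitive f t ^ 2 ∂(leb T) + ϱ / 2 * (∫ s, f s ∂(leb T)) ^ 2 := by
  have hf1 : Integrable f (leb T) := hf.integrable (by norm_num)
  set h : Time T × Time T → ℝ := fun p => if p.2 < p.1 then f p.1 * f p.2 else 0 with hh
  have hi : Integrable h ((leb T).prod (leb T)) := integrable_ite_zero
    (measurableSet_lt measurable_snd measurable_fst) (hf1.mul_prod hf1)
  -- On the triangle `p.2 < p.1` the single condition `p.1 ≤ t` puts both times before `t`.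
  -- Integrating over `t` then produces the factor `T - p.1` of the penalty kernel.
  have e1 : ∀ t : Time T, primitive f t ^ 2 =
      2 * ∫ p, (if p.1 ≤ t then h p else 0) ∂((leb T).prod (leb T)) := by
    intro t
    have := sq_integral_eq (integrable_ite_le hf1 t)
    rw [primitive, show ∀ x y : ℝ, (x = 2 * y ↔ y = 1 / 2 * x) from fun x y => by grind, ← this]
    refine integral_congr_ae (.of_forall fun p => ?_)
    simp only [hh, Subtype.coe_le_coe]
    by_cases h1 : p.2 < p.1
    · by_cases h2 : p.1 ≤ t
      · simp [h1, h2, h1.le.trans h2]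
      · simp [h1, h2]
    · simp [h1]
  have e2 : ∫ t : Time T, primitive f t ^ 2 ∂(leb T) =
      2 * ∫ p, (T - (p.1 : ℝ)) * h p ∂((leb T).prod (leb T)) := by
    rw [← integral_integral_ite_le hi measurable_fst, ← integral_const_mul]
    exact integral_congr_ae (.of_forall e1)
  have i1 : Integrable (fun p : Time T × Time T => (T - (p.1 : ℝ)) * h p)
      ((leb T).prod (leb T)) := by
    refine hi.bdd_mul (c := T) (by fun_prop) (.of_forall fun p => ?_)
    rw [Real.norm_of_nonneg (sub_nonneg.2 p.1.2.2)]
    linarith [p.1.2.1]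
  rw [e2, show ϱ / 2 * (∫ s, f s ∂(leb T)) ^ 2 = ϱ * (1 / 2 * (∫ s, f s ∂(leb T)) ^ 2) by ring,
    ← sq_integral_eq hf1, ← hh, ← mul_assoc, div_mul_cancel₀ _ two_ne_zero, ← integral_const_mul,
    ← integral_const_mul, ← integral_add (i1.const_mul φ) (hi.const_mul ϱ)]
  refine integral_congr_ae (.of_forall fun p => ?_)
  simp only [hh, penaltyKernel]
  split_ifs
  · ring
  · simp

end Paths

/-! ### Completely monotone kernels as mixtures on `(0, T]`. -/

section CompletelyMonotone

variable {T : ℝ} {g : ℝ → ℝ}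

theorem IsCompletelyMonotone.contDiffAt (hg : IsCompletelyMonotone g) {t : ℝ} (ht : 0 < t) :
    ContDiffAt ℝ ((⊤ : ℕ∞) : WithTop ℕ∞) g t :=
  hg.contDiffOn.contDiffAt (Ioi_mem_nhds ht)

theorem IsCompletelyMonotone.nonneg (hg : IsCompletelyMonotone g) {t : ℝ} (ht : 0 < t) :
    0 ≤ g t := by simpa using hg.alternating 0 t ht

theorem IsCompletelyMonotone.deriv_nonpos (hg : IsCompletelyMonotone g) {t : ℝ} (ht : 0 < t) :
    deriv g t ≤ 0 := by simpa using hg.alternating 1 t ht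

theorem IsCompletelyMonotone.deriv_deriv_nonneg (hg : IsCompletelyMonotone g) {t : ℝ}
    (ht : 0 < t) : 0 ≤ deriv (deriv g) t := by
  simpa [iteratedDeriv_succ, iteratedDeriv_zero] using hg.alternating 2 t ht

theorem IsCompletelyMonotone.contDiffOn_deriv (hg : IsCompletelyMonotone g) :
    ContDiffOn ℝ ((⊤ : ℕ∞) : WithTop ℕ∞) (deriv g) (Set.Ioi 0) :=
  hg.contDiffOn.deriv_of_isOpen isOpen_Ioi (by simp)

theorem IsCompletelyMonotone.hasDerivAt (hg : IsCompletelyMonotone g) {t : ℝ} (ht : 0 < t) :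
    HasDerivAt g (deriv g t) t :=
  ((hg.contDiffAt ht).differentiableAt (by simp)).hasDerivAt

theorem IsCompletelyMonotone.hasDerivAt_deriv (hg : IsCompletelyMonotone g) {t : ℝ} (ht : 0 < t) :
    HasDerivAt (deriv g) (deriv (deriv g) t) t :=
  ((hg.contDiffOn_deriv.contDiffAt (Ioi_mem_nhds ht)).differentiableAt (by simp)).hasDerivAt

theorem IsCompletelyMonotone.continuousOn_deriv (hg : IsCompletelyMonotone g) :
    ContinuousOn (deriv g) (Set.Ioi 0) := hg.contDiffOn_deriv.continuousOn

theorem IsCompletelyMonotone.continuousOn_deriv_deriv (hg : IsCompletelyMonotone g) :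
    ContinuousOn (deriv (deriv g)) (Set.Ioi 0) :=
  hg.contDiffOn_deriv.continuousOn_deriv_of_isOpen isOpen_Ioi (by simp)

/-- A function on `(0, T]` vanishing before `t > 0` and continuous after is integrable. -/
theorem integrableOn_mul_ite {k h : ℝ → ℝ} {t : ℝ} (ht : 0 < t) (hk : ContinuousOn k (Set.Ioi 0))
    (hh : Continuous h) :
    IntegrableOn (fun θ => k θ * (if t < θ then h θ else 0)) (Set.Ioc 0 T) := by
  have h1 : IntegrableOn (fun θ => k θ * h θ) (Set.Ioc t T) :=
    (((hk.mul hh.continuousOn).mono fun x (hx : x ∈ Set.Icc t T) =>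
      ht.trans_le hx.1).integrableOn_Icc).mono_set Set.Ioc_subset_Icc_self
  have h2 := (integrable_indicator_iff measurableSet_Ioc).2 h1
  refine IntegrableOn.congr_fun h2.integrableOn (fun θ hθ => ?_) measurableSet_Ioc
  by_cases h3 : t < θ
  · simp [h3, hθ.2]
  · simp [h3]

/-- The domain `(0, T]` does not depend on `t`, as Fubini requires, while `[t, T]` stays away from a
possible singularity at `0`. -/
theorem setIntegral_mul_ite {k h : ℝ → ℝ} {t : ℝ} (ht : 0 < t) (htT : t ≤ T) :
    ∫ θ in Set.Ioc 0 T, k θ * (if t < θ then h θ else 0) = ∫ θ in t..T, k θ * h θ := by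
  rw [intervalIntegral.integral_of_le htT, ← integral_indicator measurableSet_Ioc,
    ← integral_indicator measurableSet_Ioc]
  congr 1
  funext θ
  by_cases h1 : t < θ
  · simp [Set.indicator_apply, h1, ht.trans h1]
  · simp [Set.indicator_apply, h1]

/-- A nonincreasing function as a mixture of indicators of intervals `(0, θ)`. -/
theorem IsCompletelyMonotone.eq_add_integral_deriv (hg : IsCompletelyMonotone g) {t : ℝ}
    (ht : 0 < t) (htT : t ≤ T) :
    g t = g T + ∫ θ in Set.Ioc 0 T, -deriv g θ * (if t < θ then 1 else 0) := by
  rw [setIntegral_mul_ite (h := fun _ => 1) ht htT]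
  have h := intervalIntegral.integral_eq_sub_of_hasDerivAt (f := g) (f' := deriv g) (a := t)
    (b := T) (fun x hx => hg.hasDerivAt ?_) ?_
  · simp only [mul_one, intervalIntegral.integral_neg, h]
    ring
  · rw [Set.uIcc_of_le htT] at hx
    exact ht.trans_le hx.1
  · refine (hg.continuousOn_deriv.mono fun x hx => ?_).intervalIntegrable
    rw [Set.uIcc_of_le htT] at hx
    exact ht.trans_le hx.1

/-- A convex function as a mixture of tent functions `(θ - ·)⁺`. -/
theorem IsCompletelyMonotone.eq_add_integral_deriv_deriv (hg : IsCompletelyMonotone g) {t : ℝ}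
    (ht : 0 < t) (htT : t ≤ T) :
    g t = g T + -deriv g T * (T - t) +
      ∫ θ in Set.Ioc 0 T, deriv (deriv g) θ * (if t < θ then θ - t else 0) := by
  rw [setIntegral_mul_ite (h := fun θ => θ - t) ht htT]
  have hpos : ∀ x ∈ Set.uIcc t T, 0 < x := fun x hx => by
    rw [Set.uIcc_of_le htT] at hx
    exact ht.trans_le hx.1
  -- Integration by parts: `g'(θ) (θ - t) - g(θ)` is an antiderivative of `g''(θ) (θ - t)`.
  have h := intervalIntegral.integral_eq_sub_of_hasDerivAt
    (f := fun θ => deriv g θ * (θ - t) - g θ) (f' := fun θ => deriv (deriv g) θ * (θ - t)) (a := t)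
    (b := T) (fun x hx => ?_) ?_
  · rw [h]
    ring
  · refine (((hg.hasDerivAt_deriv (hpos x hx)).mul ((hasDerivAt_id x).sub_const t)).sub
      (hg.hasDerivAt (hpos x hx))).congr_deriv ?_
    simp
  · refine ContinuousOn.intervalIntegrable ?_
    exact (hg.continuousOn_deriv_deriv.mono hpos).mul (by fun_prop)

end CompletelyMonotone

/-! ### Positivity of the transient kernel, alone and against the inventory. -/

section Positivity

variable {T : ℝ} {g : ℝ → ℝ}

/-- The tent is the length of the overlap of `[p.1 - θ, p.1)` and `[p.2 - θ, p.2)`. It is therefore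
a mixture over `x` of rank-one kernels, each of which contributes the square of an integral of `f`.
-/
theorem integral_tent_mul_nonneg {f : Time T → ℝ} (hf : Integrable f (leb T)) {θ : ℝ}
    (hθ : 0 < θ) : 0 ≤ ∫ p : Time T × Time T, max (θ - |(p.1 : ℝ) - p.2|) 0 * (f p.1 * f p.2)
      ∂((leb T).prod (leb T)) := by
  set k : ℝ → Time T × Time T → ℝ := fun x p =>
    (if x < (p.1 : ℝ) ∧ (p.1 : ℝ) ≤ x + θ then 1 else 0) *
      (if x < (p.2 : ℝ) ∧ (p.2 : ℝ) ≤ x + θ then 1 else 0) with hk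
  have hke : ∀ p x, k x p =
      (Set.Ico (max (p.1 : ℝ) p.2 - θ) (min (p.1 : ℝ) p.2)).indicator (fun _ => (1 : ℝ)) x := by
    intro p x
    simp only [hk, Set.indicator_apply, Set.mem_Ico, sub_le_iff_le_add, max_le_iff, lt_min_iff]
    split_ifs <;> first | rfl | (simp; done) | (exfalso; tauto)
  have hkint : ∀ p, ∫ x, k x p = max (θ - |(p.1 : ℝ) - p.2|) 0 := by
    intro p
    simp only [hke]
    rw [integral_indicator measurableSet_Ico, setIntegral_const, measureReal_def, Real.volume_Ico,
      ENNReal.toReal_ofReal', smul_eq_mul, mul_one, ← max_sub_min_eq_abs']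
    congr 1
    ring
  have h := integral_mixture_mul_nonneg (ν := volume) (ρ := (leb T).prod (leb T)) (k := k)
    (w := fun p => f p.1 * f p.2) ?_ ?_ ?_ (hf.mul_prod hf).1 ?_ ?_
  · simpa only [hkint] using h
  · refine Measurable.mul ?_ ?_ <;> refine Measurable.ite ?_ measurable_const measurable_const
    · exact (measurableSet_lt (f := fun q : ℝ × Time T × Time T => q.1) (g := fun q => (q.2.1 : ℝ))
          (by fun_prop) (by fun_prop)).inter
        (measurableSet_le (f := fun q : ℝ × Time T × Time T => (q.2.1 : ℝ))
          (g := fun q => q.1 + θ) (by fun_prop) (by fun_prop))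
    · exact (measurableSet_lt (f := fun q : ℝ × Time T × Time T => q.1) (g := fun q => (q.2.2 : ℝ))
          (by fun_prop) (by fun_prop)).inter
        (measurableSet_le (f := fun q : ℝ × Time T × Time T => (q.2.2 : ℝ))
          (g := fun q => q.1 + θ) (by fun_prop) (by fun_prop))
  · refine .of_forall fun x p => ?_
    simp only [hk]
    split_ifs <;> simp
  · intro p
    simp only [hke]
    exact (integrable_indicator_iff measurableSet_Ico).2 (integrableOn_const measure_Ico_lt_top.ne)
  · simp only [hkint]
    refine (hf.mul_prod hf).bdd_mul (c := θ) (by fun_prop) (.of_forall fun p => ?_)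
    rw [Real.norm_of_nonneg (le_max_right _ _)]
    exact max_le (by linarith [abs_nonneg ((p.1 : ℝ) - p.2)]) hθ.le
  · refine .of_forall fun x => ?_
    have e : ∀ p : Time T × Time T, k x p * (f p.1 * f p.2) =
        ((if x < (p.1 : ℝ) ∧ (p.1 : ℝ) ≤ x + θ then 1 else 0) * f p.1) *
        ((if x < (p.2 : ℝ) ∧ (p.2 : ℝ) ≤ x + θ then 1 else 0) * f p.2) := fun p => by
      simp only [hk]; ring
    simp only [e]
    rw [integral_prod_mul (μ := leb T) (ν := leb T)
      (fun s : Time T => (if x < (s : ℝ) ∧ (s : ℝ) ≤ x + θ then 1 else 0) * f s)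
      (fun s : Time T => (if x < (s : ℝ) ∧ (s : ℝ) ≤ x + θ then 1 else 0) * f s)]
    exact mul_self_nonneg _

/-- The Volterra operator of a tent function is positive. -/
theorem integral_tent_triangle_nonneg {f : Time T → ℝ} (hf : Integrable f (leb T)) {θ : ℝ}
    (hθ : 0 < θ) : 0 ≤ ∫ p : Time T × Time T,
      (if p.2 < p.1 then max (θ - ((p.1 : ℝ) - p.2)) 0 * (f p.1 * f p.2) else 0)
      ∂((leb T).prod (leb T)) := by
  have h := integral_triangle_of_symm (ρ := leb T)
    (h := fun p => max (θ - |(p.1 : ℝ) - p.2|) 0 * (f p.1 * f p.2)) ?_ ?_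
  · have h0 := integral_tent_mul_nonneg hf hθ
    refine (le_of_le_of_eq (by positivity) h.symm).trans_eq ?_
    refine integral_congr_ae (.of_forall fun p => ?_)
    by_cases hp : p.2 < p.1
    · have : (p.2 : ℝ) < p.1 := hp
      simp [hp, abs_of_pos (sub_pos.2 this)]
    · simp [hp]
  · refine (hf.mul_prod hf).bdd_mul (c := θ) (by fun_prop) (.of_forall fun p => ?_)
    rw [Real.norm_of_nonneg (le_max_right _ _)]
    exact max_le (by linarith [abs_nonneg ((p.1 : ℝ) - p.2)]) hθ.le
  · intro p
    simp only [Prod.fst_swap, Prod.snd_swap]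
    rw [abs_sub_comm, mul_comm (f p.2)]

/-- The Volterra operator of a completely monotone kernel is positive, path by path. -/
theorem IsCompletelyMonotone.integral_convKernel_nonneg (hT : 0 < T) (hg : IsCompletelyMonotone g)
    (ha : IsAdmissible (convKernel T g)) {f : Time T → ℝ} (hf : MemLp f 2 (leb T)) :
    0 ≤ ∫ p, convKernel T g p.1 p.2 * (f p.1 * f p.2) ∂((leb T).prod (leb T)) := by
  have hf1 : Integrable f (leb T) := hf.integrable (by norm_num)
  have hlt : MeasurableSet {p : Time T × Time T | p.2 < p.1} :=
    measurableSet_lt measurable_snd measurable_fst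
  set k : ℝ → Time T × Time T → ℝ := fun θ p => if p.2 < p.1 then deriv (deriv g) θ *
    (if (p.1 : ℝ) - p.2 < θ then θ - ((p.1 : ℝ) - p.2) else 0) else 0 with hk
  have hsub : ∀ p : Time T × Time T, p.2 < p.1 → 0 < (p.1 : ℝ) - p.2 ∧ (p.1 : ℝ) - p.2 ≤ T :=
    fun p hp => ⟨sub_pos.2 hp, by linarith [p.1.2.2, p.2.2.1]⟩
  have hmax : ∀ θ x : ℝ, (if x < θ then θ - x else 0) = max (θ - x) 0 := fun θ x => by
    split_ifs with h
    · rw [max_eq_left (by linarith)]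
    · rw [max_eq_right (by linarith)]
  set F₁ : Time T × Time T → ℝ := fun p => if p.2 < p.1 then f p.1 * f p.2 else 0
  set F₂ : Time T × Time T → ℝ := fun p =>
    if p.2 < p.1 then max (T - ((p.1 : ℝ) - p.2)) 0 * (f p.1 * f p.2) else 0
  have i1 : Integrable F₁ ((leb T).prod (leb T)) := integrable_ite_zero hlt (hf1.mul_prod hf1)
  have i2 : Integrable F₂ ((leb T).prod (leb T)) := by
    refine integrable_ite_zero hlt ((hf1.mul_prod hf1).bdd_mul (c := T + T) (by fun_prop)
      (.of_forall fun p => ?_))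
    rw [Real.norm_of_nonneg (le_max_right _ _)]
    exact max_le (by linarith [p.1.2.1, p.2.2.2]) (by linarith)
  -- Taylor's formula at `T` splits `g` into the constant `g T`, a tent of width `T` with weight
  -- `-g' T`, and tents of width `θ` with weight `g'' θ`. The maximum in `F₂` is harmless, as no lag
  -- exceeds `T`.
  have e : ∀ p : Time T × Time T, (∫ θ in Set.Ioc 0 T, k θ p) * (f p.1 * f p.2) =
      convKernel T g p.1 p.2 * (f p.1 * f p.2) - g T * F₁ p - -deriv g T * F₂ p := by
    intro p
    by_cases hp : p.2 < p.1
    · simp only [hk, F₁, F₂, convKernel, if_pos hp]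
      rw [hg.eq_add_integral_deriv_deriv (hsub p hp).1 (hsub p hp).2,
        max_eq_left (by linarith [(hsub p hp).2])]
      ring
    · simp [hk, F₁, F₂, convKernel, hp]
  have i0 := ha.integrable_mul (isCausal_convKernel g) hf hf
  -- Integrability of the mixture comes by difference from the admissibility of `g`; no estimate of
  -- `g''` near `0` is involved.
  have i3 : Integrable (fun p : Time T × Time T => (∫ θ in Set.Ioc 0 T, k θ p) * (f p.1 * f p.2))
      ((leb T).prod (leb T)) := by
    simp only [e]
    exact (i0.sub (i1.const_mul _)).sub (i2.const_mul _)
  have h3 := integral_mixture_mul_nonneg (ν := volume.restrict (Set.Ioc 0 T)) (k := k)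
    ?_ ?_ ?_ (hf1.mul_prod hf1).1 i3 ?_
  · have h1 : 0 ≤ ∫ p, F₁ p ∂((leb T).prod (leb T)) := by
      rw [sq_integral_eq hf1]; positivity
    have h2 : 0 ≤ ∫ p, F₂ p ∂((leb T).prod (leb T)) := integral_tent_triangle_nonneg hf1 hT
    simp only [e] at h3
    rw [integral_sub (f := fun p => convKernel T g p.1 p.2 * (f p.1 * f p.2) - g T * F₁ p)
      (i0.sub (i1.const_mul _)) (i2.const_mul _), integral_sub i0 (i1.const_mul _),
      integral_const_mul, integral_const_mul] at h3
    have h4 := mul_nonneg (hg.nonneg hT) h1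
    have h5 := mul_nonneg (neg_nonneg.2 (hg.deriv_nonpos hT)) h2
    linarith
  · refine Measurable.ite (measurableSet_lt (by fun_prop) (by fun_prop)) ?_ measurable_const
    refine ((measurable_deriv _).comp measurable_fst).mul ?_
    exact Measurable.ite (measurableSet_lt (by fun_prop) (by fun_prop)) (by fun_prop)
      measurable_const
  · filter_upwards [ae_restrict_mem measurableSet_Ioc] with θ hθ p
    simp only [hk, hmax]
    split_ifs
    · exact mul_nonneg (hg.deriv_deriv_nonneg hθ.1) (le_max_right _ _)
    · exact le_rfl
  · intro p
    by_cases hp : p.2 < p.1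
    · simp only [hk, if_pos hp]
      exact integrableOn_mul_ite (h := fun θ => θ - ((p.1 : ℝ) - p.2)) (hsub p hp).1
        hg.continuousOn_deriv_deriv (by fun_prop)
    · simp [hk, hp]
  · filter_upwards [ae_restrict_mem measurableSet_Ioc] with θ hθ
    have h := mul_nonneg (hg.deriv_deriv_nonneg hθ.1) (integral_tent_triangle_nonneg hf1 hθ.1)
    rw [← integral_const_mul] at h
    refine h.trans_eq (integral_congr_ae (.of_forall fun p => ?_))
    simp only [hk, hmax]
    split_ifs <;> ring

/-- Integrating in `p.2` gives `V(t) - V(t - θ)`, where `V = primitive f`, which reduces the form to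
the shift inequality. -/
theorem integral_interval_mul_primitive_nonneg {f : Time T → ℝ} (hf : Integrable f (leb T)) {θ : ℝ}
    (hθ : 0 < θ) : 0 ≤ ∫ p : Time T × Time T,
      (if p.2 < p.1 ∧ (p.1 : ℝ) - p.2 < θ then 1 else 0) * (primitive f p.1 * f p.2)
      ∂((leb T).prod (leb T)) := by
  have hV : Integrable (fun t : Time T => primitive f t) (leb T) :=
    (memLp_primitive hf).integrable (by norm_num)
  rw [integral_prod]
  · refine (integral_primitive_mul_sub_nonneg hf hθ).trans_eq
      (integral_congr_ae (.of_forall fun t => ?_))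
    simp only [primitive_sub_primitive hf hθ, ← integral_const_mul]
    refine integral_congr_ae (.of_forall fun s => ?_)
    simp only
    split_ifs <;> ring
  · simp only [ite_mul, one_mul, zero_mul]
    refine integrable_ite_zero ?_ (hV.mul_prod hf)
    exact (measurableSet_lt (by fun_prop) (by fun_prop)).inter
      (measurableSet_lt (f := fun p : Time T × Time T => (p.1 : ℝ) - p.2) (g := fun _ => θ)
        (by fun_prop) (by fun_prop))

/-- The impact of a nonincreasing kernel is positively correlated with the inventory. -/
theorem IsCompletelyMonotone.integral_convKernel_mul_primitive_nonneg (hT : 0 < T)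
    (hg : IsCompletelyMonotone g) (ha : IsAdmissible (convKernel T g)) {f : Time T → ℝ}
    (hf : MemLp f 2 (leb T)) :
    0 ≤ ∫ p, convKernel T g p.1 p.2 * (primitive f p.1 * f p.2) ∂((leb T).prod (leb T)) := by
  have hf1 : Integrable f (leb T) := hf.integrable (by norm_num)
  have hV : Integrable (fun t : Time T => primitive f t) (leb T) :=
    (memLp_primitive hf1).integrable (by norm_num)
  have hlt : MeasurableSet {p : Time T × Time T | p.2 < p.1} :=
    measurableSet_lt measurable_snd measurable_fst
  set k : ℝ → Time T × Time T → ℝ := fun θ p => if p.2 < p.1 then -deriv g θ *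
    (if (p.1 : ℝ) - p.2 < θ then 1 else 0) else 0 with hk
  have hsub : ∀ p : Time T × Time T, p.2 < p.1 → 0 < (p.1 : ℝ) - p.2 ∧ (p.1 : ℝ) - p.2 ≤ T :=
    fun p hp => ⟨sub_pos.2 hp, by linarith [p.1.2.2, p.2.2.1]⟩
  set F₁ : Time T × Time T → ℝ := fun p => if p.2 < p.1 then primitive f p.1 * f p.2 else 0 with hF
  have i1 : Integrable F₁ ((leb T).prod (leb T)) := integrable_ite_zero hlt (hV.mul_prod hf1)
  -- Here `g` is the constant `g T` plus indicators of `(0, θ)` with weights `-g' θ ≥ 0`.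
  have e : ∀ p : Time T × Time T, (∫ θ in Set.Ioc 0 T, k θ p) * (primitive f p.1 * f p.2) =
      convKernel T g p.1 p.2 * (primitive f p.1 * f p.2) - g T * F₁ p := by
    intro p
    by_cases hp : p.2 < p.1
    · simp only [hk, F₁, convKernel, if_pos hp]
      rw [hg.eq_add_integral_deriv (hsub p hp).1 (hsub p hp).2]
      ring
    · simp [hk, F₁, convKernel, hp]
  have i0 := ha.integrable_mul (isCausal_convKernel g) (memLp_primitive hf1) hf
  have i3 : Integrable (fun p : Time T × Time T =>
      (∫ θ in Set.Ioc 0 T, k θ p) * (primitive f p.1 * f p.2)) ((leb T).prod (leb T)) := by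
    simp only [e]
    exact i0.sub (i1.const_mul _)
  have h3 := integral_mixture_mul_nonneg (ν := volume.restrict (Set.Ioc 0 T)) (k := k)
    ?_ ?_ ?_ (hV.mul_prod hf1).1 i3 ?_
  · have h1 : 0 ≤ ∫ p, F₁ p ∂((leb T).prod (leb T)) := by
      -- The constant kernel is a window wider than every lag; `T + 1` makes the strict inequality
      -- hold even for the lag `T`.
      refine (integral_interval_mul_primitive_nonneg hf1 (show 0 < T + 1 by linarith)).trans_eq
        (integral_congr_ae (.of_forall fun p => ?_))
      have : (p.1 : ℝ) - p.2 < T + 1 := by linarith [p.1.2.2, p.2.2.1]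
      simp [hF, this]
    simp only [e] at h3
    rw [integral_sub i0 (i1.const_mul _), integral_const_mul] at h3
    have h4 := mul_nonneg (hg.nonneg hT) h1
    linarith
  · refine Measurable.ite (measurableSet_lt (by fun_prop) (by fun_prop)) ?_ measurable_const
    refine ((measurable_deriv _).comp measurable_fst).neg.mul ?_
    exact Measurable.ite (measurableSet_lt (by fun_prop) (by fun_prop)) measurable_const
      measurable_const
  · filter_upwards [ae_restrict_mem measurableSet_Ioc] with θ hθ p
    have := hg.deriv_nonpos hθ.1
    simp only [hk]
    split_ifs <;> simp [this]
  · intro p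
    by_cases hp : p.2 < p.1
    · simp only [hk, if_pos hp]
      exact integrableOn_mul_ite (k := fun θ => -deriv g θ) (h := fun _ => 1) (hsub p hp).1
        hg.continuousOn_deriv.neg continuous_const
    · simp [hk, hp]
  · filter_upwards [ae_restrict_mem measurableSet_Ioc] with θ hθ
    have h := mul_nonneg (neg_nonneg.2 (hg.deriv_nonpos hθ.1))
      (integral_interval_mul_primitive_nonneg hf1 hθ.1)
    rw [← integral_const_mul] at h
    refine h.trans_eq (integral_congr_ae (.of_forall fun p => ?_))
    simp only [hk, ite_and]
    split_ifs <;> ring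

end Positivity

/-! ### The resolvent `(1 + a G)⁻¹` and positivity of the effective impact. -/

section Resolvent

variable {E : Type*} [NormedAddCommGroup E] [InnerProductSpace ℝ E]

theorem eq_smul_apply_sub_iff {a : ℝ} {G : E →L[ℝ] E} (hu : IsUnit (1 + a • G)) (u r : E) :
    r = a • G (u - r) ↔ r = u - Ring.inverse (1 + a • G) u := by
  have h1 : ∀ v, (1 + a • G) (Ring.inverse (1 + a • G) v) = v := fun v => by
    have h := congrArg (fun A : E →L[ℝ] E => A v) (Ring.mul_inverse_cancel _ hu)
    simpa using h
  have h2 : ∀ v, Ring.inverse (1 + a • G) ((1 + a • G) v) = v := fun v => by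
    have h := congrArg (fun A : E →L[ℝ] E => A v) (Ring.inverse_mul_cancel _ hu)
    simpa using h
  have e : (1 + a • G) (u - r) = u - r + a • G (u - r) := rfl
  constructor
  · intro h
    rw [← h, sub_add_cancel] at e
    rw [← e, h2, e]
    abel
  · intro h
    have : u - r = Ring.inverse (1 + a • G) u := by rw [h]; abel
    rw [this, h1, ← this] at e
    have := sub_eq_of_eq_add' e
    rwa [sub_sub_cancel] at this

variable [CompleteSpace E]

theorem isUnit_one_add_smul {a : ℝ} (ha : 0 ≤ a) {G : E →L[ℝ] E} (hG : ∀ u, 0 ≤ inner ℝ u (G u)) :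
    IsUnit (1 + a • G) :=
  isUnit_one_add_of_inner_nonneg _ fun u => by
    rw [smul_apply, inner_smul_right]
    exact mul_nonneg ha (hG u)

/-- Substituting `u = v + a G v` leaves four nonnegative terms. Positivity of `G` and `H` alone does
not control the cross term `a ⟪G v, H v⟫`, hence the hypothesis `hGH`. -/
theorem inner_mul_inverse_nonneg {a : ℝ} (ha : 0 ≤ a) {G H : E →L[ℝ] E}
    (hG : ∀ u, 0 ≤ inner ℝ u (G u)) (hH : ∀ u, 0 ≤ inner ℝ u (H u))
    (hGH : ∀ u, 0 ≤ inner ℝ (G u) (H u)) (u : E) :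
    0 ≤ inner ℝ u (((H + G) * Ring.inverse (1 + a • G)) u) := by
  set v := Ring.inverse (1 + a • G) u with hv
  have hu : u = v + a • G v := by
    have h := congrArg (fun A : E →L[ℝ] E => A u)
      (Ring.mul_inverse_cancel _ (isUnit_one_add_smul ha hG))
    simpa [← hv] using h.symm
  have e : ((H + G) * Ring.inverse (1 + a • G)) u = H v + G v := rfl
  rw [e]
  nth_rewrite 1 [hu]
  simp only [inner_add_left, inner_add_right, inner_smul_left, conj_trivial,
    real_inner_self_eq_norm_sq]
  have h1 := hG v
  have h2 := hH v
  have h3 := hGH v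
  positivity

/-- Brings the gradient of the quadratic form to the shape it has in the first-order condition. -/
theorem adjoint_mul_inverse (a : ℝ) (G H : E →L[ℝ] E) :
    ContinuousLinearMap.adjoint ((H + G) * Ring.inverse (1 + a • G)) =
      Ring.inverse (1 + a • ContinuousLinearMap.adjoint G) *
        (ContinuousLinearMap.adjoint H + ContinuousLinearMap.adjoint G) := by
  simp only [← ContinuousLinearMap.star_eq_adjoint]
  rw [star_mul, ← Ring.inverse_star, star_add, star_add, star_one, star_smul, star_trivial]

end Resolvent

/-! ### From paths to progressive processes. -/

section Processes

variable {T : ℝ} {Ω : Type*} {mΩ : MeasurableSpace Ω} {ℱ : Filtration (Time T) mΩ} {μ : Measure Ω}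

theorem memLp_coe (u : ProgL2 ℱ μ) : MemLp (u : Time T × Ω → ℝ) 2 ((leb T).prod μ) := Lp.memLp u.1

theorem progL2_ext {u v : ProgL2 ℱ μ}
    (h : (u : Time T × Ω → ℝ) =ᵐ[(leb T).prod μ] (v : Time T × Ω → ℝ)) : u = v :=
  Subtype.ext (Lp.ext h)

theorem inner_eq_integral (u v : ProgL2 ℱ μ) : inner ℝ u v =
    ∫ p, (u : Time T × Ω → ℝ) p * (v : Time T × Ω → ℝ) p ∂((leb T).prod μ) := by
  rw [Submodule.coe_inner, L2.inner_def]
  exact integral_congr_ae (.of_forall fun p => mul_comm _ _)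

theorem inner_eq_integral_integral [SFinite μ] (u v : ProgL2 ℱ μ) : inner ℝ u v =
    ∫ ω, ∫ t, (u : Time T × Ω → ℝ) (t, ω) * (v : Time T × Ω → ℝ) (t, ω) ∂(leb T) ∂μ := by
  rw [inner_eq_integral, integral_prod_symm]
  exact (memLp_coe u).integrable_mul (memLp_coe v)

theorem coeFn_volterra [SFinite μ] {K : Time T → Time T → ℝ} (hK : IsAdmissible K)
    (u : ProgL2 ℱ μ) : (volterra ℱ μ K hK u : Time T × Ω → ℝ) =ᵐ[(leb T).prod μ]
      volterraFun K (u : Time T × Ω → ℝ) :=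
  MemLp.coeFn_toLp (memLp_volterraFun ℱ hK u)

theorem ae_ae_path_eq [SFinite μ] {u v : Time T × Ω → ℝ} (h : u =ᵐ[(leb T).prod μ] v) :
    ∀ᵐ ω ∂μ, ∀ᵐ t ∂(leb T), u (t, ω) = v (t, ω) :=
  Measure.ae_ae_of_ae_prod
    ((Measure.measurePreserving_swap (μ := μ) (ν := leb T)).quasiMeasurePreserving.ae h)

theorem volterraFun_const (κ : ℝ) (u : Time T × Ω → ℝ) (t : Time T) (ω : Ω) :
    volterraFun (convKernel T fun _ => κ) u (t, ω) = κ * primitive (fun s => u (s, ω)) t := by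
  rw [volterraFun, primitive, ← integral_const_mul]
  simp only
  rw [(isCausal_convKernel fun _ => κ).setIntegral_Iic (fun s => u (s, ω)) t]
  refine integral_congr_ae ?_
  filter_upwards [Measure.ae_ne (leb T) t] with s hs
  have h1 : s < t ↔ (s : ℝ) ≤ t := ⟨fun h => h.le, fun h => lt_of_le_of_ne h hs⟩
  simp only [convKernel, h1]
  split_ifs <;> simp

/-- Makes permanent impact an instance of transient impact, so that its positivity needs no separate
proof. -/
theorem isCompletelyMonotone_const {κ : ℝ} (hκ : 0 ≤ κ) : IsCompletelyMonotone fun _ => κ := by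
  refine ⟨contDiffOn_const, fun n t _ => ?_⟩
  cases n with
  | zero => simpa using hκ
  | succ n => simp [iteratedDeriv_const]

theorem isResistance_iff {U : ℝ → ℝ} {a : ℝ} (hU : ∀ x, U x = a * x)
    (G : ProgL2 ℱ μ →L[ℝ] ProgL2 ℱ μ)
    (u r : ProgL2 ℱ μ) : IsResistance U G u r ↔ r = a • G (u - r) := by
  have h : ((a • G (u - r) : ProgL2 ℱ μ) : Time T × Ω → ℝ) =ᵐ[(leb T).prod μ]
      fun p => U ((G (u - r) : Time T × Ω → ℝ) p) := by
    refine (Lp.coeFn_smul a (G (u - r)).1).trans (.of_forall fun p => ?_)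
    simp [hU]
  constructor
  · exact fun h1 => progL2_ext (EventuallyEq.trans h1 h.symm)
  · intro h1
    rw [IsResistance]
    nth_rewrite 1 [h1]
    exact h

theorem existsUnique_isResistance {U : ℝ → ℝ} {a : ℝ} (hU : ∀ x, U x = a * x)
    {G : ProgL2 ℱ μ →L[ℝ] ProgL2 ℱ μ} (hG : IsUnit (1 + a • G)) (u : ProgL2 ℱ μ) :
    ∃! r, IsResistance U G u r := by
  simp only [isResistance_iff hU, eq_smul_apply_sub_iff hG, existsUnique_eq]

/-- Uniqueness of the resistance forces the chosen solution to be `u - (1 + a G)⁻¹ u`. -/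
theorem impact_eq {U : ℝ → ℝ} {a : ℝ} (hU : ∀ x, U x = a * x)
    {G : ProgL2 ℱ μ →L[ℝ] ProgL2 ℱ μ} (hG : IsUnit (1 + a • G)) (H : ProgL2 ℱ μ →L[ℝ] ProgL2 ℱ μ)
    (γ : ℝ) (u : ProgL2 ℱ μ) :
    impact U H G γ u = (γ / 2) • u + ((H + G) * Ring.inverse (1 + a • G)) u := by
  have h : ∃ r, IsResistance U G u r := (existsUnique_isResistance hU hG u).exists
  have h1 := h.choose_spec
  rw [isResistance_iff hU, eq_smul_apply_sub_iff hG] at h1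
  rw [impact, resistance, dif_pos h, h1, sub_sub_cancel]
  rfl

variable [SFinite μ]

/-- A Volterra operator acts on each path separately, so by Fubini its quadratic form is the
expectation of a form over paths. -/
theorem inner_volterra_nonneg {K : Time T → Time T → ℝ} (hK : IsAdmissible K) (hc : IsCausal K)
    (h : ∀ f : Time T → ℝ, MemLp f 2 (leb T) →
      0 ≤ ∫ p, K p.1 p.2 * (f p.1 * f p.2) ∂((leb T).prod (leb T))) (u : ProgL2 ℱ μ) :
    0 ≤ inner ℝ u (volterra ℱ μ K hK u) := by
  rw [inner_eq_integral_integral]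
  refine integral_nonneg_of_ae ?_
  filter_upwards [ae_memLp_path (memLp_coe u), ae_ae_path_eq (coeFn_volterra hK u)] with ω h1 h2
  refine (h _ h1).trans_eq ?_
  rw [← hK.integral_mul_volterra hc h1 h1]
  refine integral_congr_ae ?_
  filter_upwards [h2] with t ht
  rw [ht, volterraFun]

theorem inner_transientOp_nonneg (hT : 0 < T) {g : ℝ → ℝ} (hg : IsCompletelyMonotone g)
    (ha : IsAdmissible (convKernel T g)) (u : ProgL2 ℱ μ) :
    0 ≤ inner ℝ u (transientOp ℱ μ g ha u) :=
  inner_volterra_nonneg ha (isCausal_convKernel g)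
    (fun _ hf => hg.integral_convKernel_nonneg hT ha hf) u

theorem inner_permanentOp_nonneg (hT : 0 < T) {κ : ℝ} (hκ : 0 ≤ κ) (u : ProgL2 ℱ μ) :
    0 ≤ inner ℝ u (permanentOp ℱ μ κ u) :=
  inner_transientOp_nonneg hT (isCompletelyMonotone_const hκ) _ u

theorem inner_transientOp_permanentOp_nonneg (hT : 0 < T) {g : ℝ → ℝ}
    (hg : IsCompletelyMonotone g) (ha : IsAdmissible (convKernel T g)) {κ : ℝ} (hκ : 0 ≤ κ)
    (u : ProgL2 ℱ μ) :
    0 ≤ inner ℝ (transientOp ℱ μ g ha u) (permanentOp ℱ μ κ u) := by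
  rw [inner_eq_integral_integral]
  refine integral_nonneg_of_ae ?_
  filter_upwards [ae_memLp_path (memLp_coe u), ae_ae_path_eq (coeFn_volterra ha u),
    ae_ae_path_eq (coeFn_volterra (isAdmissible_convKernel_const T κ) u)] with ω h1 h2 h3
  refine (mul_nonneg hκ (hg.integral_convKernel_mul_primitive_nonneg hT ha h1)).trans_eq ?_
  rw [← ha.integral_mul_volterra (isCausal_convKernel g)
    (memLp_primitive (h1.integrable (by norm_num))) h1, ← integral_const_mul]
  refine integral_congr_ae ?_
  filter_upwards [h2, h3] with t ht ht'
  rw [ht, ht', volterraFun_const, volterraFun]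
  ring

theorem inner_penaltyOp_nonneg {φ ϱ : ℝ} (hφ : 0 ≤ φ) (hϱ : 0 ≤ ϱ) (u : ProgL2 ℱ μ) :
    0 ≤ inner ℝ u (penaltyOp ℱ μ φ ϱ u) := by
  refine inner_volterra_nonneg _ (isCausal_penaltyKernel φ ϱ) (fun f hf => ?_) u
  rw [integral_penaltyKernel φ ϱ hf]
  have : 0 ≤ ∫ t : Time T, primitive f t ^ 2 ∂(leb T) := integral_nonneg fun _ => sq_nonneg _
  positivity

end Processes

/-! ### The unaffected price and its signal. -/

section Price

variable {T : ℝ} {Ω : Type*} {mΩ : MeasurableSpace Ω} {ℱ : Filtration (Time T) mΩ} {μ : Measure Ω}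

theorem integrable_mul_coe (u v : ProgL2 ℱ μ) :
    Integrable (fun p => (u : Time T × Ω → ℝ) p * (v : Time T × Ω → ℝ) p) ((leb T).prod μ) :=
  (memLp_coe u).integrable_mul (memLp_coe v)

theorem measurable_uncurry_of_isProgressive {X : Time T → Ω → ℝ} (hX : IsProgressive ℱ X) :
    Measurable (Function.uncurry X) :=
  ((measurable_progSigma_iff ℱ (Function.uncurry X)).2 hX).mono (progSigma_le ℱ) le_rfl

theorem measurable_of_isProgressive {X : Time T → Ω → ℝ} (hX : IsProgressive ℱ X) (t : Time T) :
    Measurable[ℱ t] (X t) :=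
  (hX t).comp (@measurable_prodMk_left _ _ _ (ℱ t) (⟨t, Set.self_mem_Iic⟩ : Set.Iic t))

/-- A square-integrable martingale on `[0, T]` is square-integrable for `dt ⊗ μ`. -/
theorem memLp_uncurry_martingale [IsProbabilityMeasure μ] (hT : 0 < T) {M : Time T → Ω → ℝ}
    (hp : IsProgressive ℱ M) (hM : Martingale M ℱ μ) (h2 : ∀ t, MemLp (M t) 2 μ) :
    MemLp (Function.uncurry M) 2 ((leb T).prod μ) := by
  have hm := measurable_uncurry_of_isProgressive hp
  refine ⟨hm.aestronglyMeasurable, ?_⟩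
  rw [eLpNorm_lt_top_iff_lintegral_rpow_enorm_lt_top (by norm_num) (by norm_num)]
  simp only [ENNReal.toReal_ofNat, ENNReal.rpow_ofNat]
  rw [lintegral_prod _ (hm.enorm.pow_const 2).aemeasurable]
  have he : ∀ X : Ω → ℝ, ∫⁻ ω, ‖X ω‖ₑ ^ 2 ∂μ = eLpNorm X 2 μ ^ 2 := fun X => by
    rw [eLpNorm_eq_lintegral_rpow_enorm_toReal (by norm_num) (by norm_num), ← ENNReal.rpow_natCast,
      ← ENNReal.rpow_mul]
    norm_num
  refine lt_of_le_of_lt (lintegral_mono fun t => ?_) (lintegral_const_lt_top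
    (c := eLpNorm (M (terminal hT)) 2 μ ^ 2) (ENNReal.pow_lt_top (h2 _).2).ne)
  refine (he (M t)).trans_le (pow_le_pow_left' ?_ 2)
  -- `M t` is the conditional expectation of `M T`, and conditional expectation contracts `L²`; this
  -- bounds all times by the terminal one.
  rw [← eLpNorm_congr_ae (hM.condExp_ae_eq (show t ≤ terminal hT from t.2.2))]
  exact eLpNorm_condExp_le_eLpNorm _ (by norm_num)

/-- Against a progressive control, the price increment until `T` may be replaced by the signal. -/
theorem integral_increment_mul_eq_inner [IsProbabilityMeasure μ] (hT : 0 < T) {S : Time T → Ω → ℝ}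
    (hS : MemLp (Function.uncurry S) 2 ((leb T).prod μ)) (hST : MemLp (S (terminal hT)) 2 μ)
    {α : ProgL2 ℱ μ} (hα : IsAlphaSignal hT S α) (u : ProgL2 ℱ μ) :
    ∫ p, (S (terminal hT) p.2 - S p.1 p.2) * (u : Time T × Ω → ℝ) p ∂((leb T).prod μ) =
      inner ℝ α u := by
  have hD : MemLp (fun p : Time T × Ω => S (terminal hT) p.2 - S p.1 p.2) 2 ((leb T).prod μ) :=
    (hST.comp_snd (leb T)).sub hS
  have hi : Integrable (fun p => (S (terminal hT) p.2 - S p.1 p.2) * (u : Time T × Ω → ℝ) p)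
      ((leb T).prod μ) := hD.integrable_mul (memLp_coe u)
  have hi' := integrable_mul_coe α u
  rw [inner_eq_integral, integral_prod _ hi, integral_prod _ hi']
  obtain ⟨v, hv, huv⟩ := lpMeas.aestronglyMeasurable u
  have hvp := (measurable_progSigma_iff ℱ v).1 hv.measurable
  refine integral_congr_ae ?_
  filter_upwards [hα, Measure.ae_ae_of_ae_prod huv, hi.prod_right_ae,
    (hD.integrable (by norm_num)).prod_right_ae] with t h1 h2 h3 h4
  have h2' : (fun ω => (u : Time T × Ω → ℝ) (t, ω)) =ᵐ[μ] fun ω => v (t, ω) := h2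
  -- The progressive representative makes `u_t` measurable for `ℱ t`, so it can be pulled out of the
  -- conditional expectation of the increment.
  have h5 : AEStronglyMeasurable[ℱ t] (fun ω => (u : Time T × Ω → ℝ) (t, ω)) μ :=
    ⟨_, (measurable_of_isProgressive hvp t).stronglyMeasurable, h2'⟩
  have h6 := condExp_mul_of_aestronglyMeasurable_right h5
    (f := fun ω => S (terminal hT) ω - S t ω) h3 h4
  have h7 := integral_condExp (ℱ.le t) (μ := μ)
    (f := (fun ω => S (terminal hT) ω - S t ω) * fun ω => (u : Time T × Ω → ℝ) (t, ω))
  refine h7.symm.trans (integral_congr_ae ?_)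
  filter_upwards [h6, h1] with ω h8 h9
  rw [h8, h9]
  rfl

/-- Lets the deterministic term `X₀ (φ (T - t) + ϱ)` enter the Hilbert space as the vector `D`. -/
theorem exists_memLp_progressive [IsFiniteMeasure μ] {d : Time T → ℝ} (hd : Measurable d) {C : ℝ}
    (hC : ∀ t, |d t| ≤ C) :
    ∃ D : ProgL2 ℱ μ, (D : Time T × Ω → ℝ) =ᵐ[(leb T).prod μ] fun p => d p.1 := by
  have hm : Measurable[progSigma ℱ] fun p : Time T × Ω => d p.1 := by
    rw [measurable_progSigma_iff]
    intro t
    exact hd.comp (measurable_subtype_coe.comp (@measurable_fst _ _ _ (ℱ t)))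
  have h2 : MemLp (fun p : Time T × Ω => d p.1) 2 ((leb T).prod μ) :=
    MemLp.of_bound (hm.mono (progSigma_le ℱ) le_rfl).aestronglyMeasurable C
      (.of_forall fun p => hC p.1)
  exact ⟨⟨h2.toLp _, mem_lpMeas_iff_aestronglyMeasurable.2
    (hm.stronglyMeasurable.aestronglyMeasurable.congr h2.coeFn_toLp.symm)⟩, h2.coeFn_toLp⟩

end Price

/-! ### The performance as a quadratic functional. -/

section Performance

variable {T : ℝ}

theorem leb_real_univ (hT : 0 < T) : (leb T).real Set.univ = T := by
  have h := leb_real_Ici (T := T) ⟨0, le_rfl, hT.le⟩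
  have e : Set.Ici (⟨0, le_rfl, hT.le⟩ : Time T) = Set.univ :=
    Set.eq_univ_of_forall fun t => t.2.1
  simpa [e] using h

theorem integral_sub_sub_sub {E : Type*} [MeasurableSpace E] {ρ : Measure E} {f₁ f₂ f₃ f₄ : E → ℝ}
    (h₁ : Integrable f₁ ρ) (h₂ : Integrable f₂ ρ) (h₃ : Integrable f₃ ρ) (h₄ : Integrable f₄ ρ) :
    ∫ x, (f₁ x - f₂ x - f₃ x - f₄ x) ∂ρ =
      (∫ x, f₁ x ∂ρ) - (∫ x, f₂ x ∂ρ) - (∫ x, f₃ x ∂ρ) - ∫ x, f₄ x ∂ρ := by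
  have h₁₂ : Integrable (fun x => f₁ x - f₂ x) ρ := h₁.sub h₂
  have h₁₃ : Integrable (fun x => f₁ x - f₂ x - f₃ x) ρ := h₁₂.sub h₃
  rw [integral_sub h₁₃ h₄, integral_sub h₁₂ h₃, integral_sub h₁ h₂]

/-- The profit and loss along a path, with all the penalties written as time integrals
against the control. -/
theorem path_pnl_eq (hT : 0 < T) {f S I : Time T → ℝ} (hf : MemLp f 2 (leb T))
    (hS : MemLp S 2 (leb T)) (hI : MemLp I 2 (leb T)) (ST X₀ φ ϱ : ℝ) :
    -(∫ t, (S t + I t) * f t ∂(leb T)) + (X₀ + ∫ s, f s ∂(leb T)) * ST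
      - φ / 2 * (∫ t : Time T, (X₀ + primitive f t) ^ 2 ∂(leb T))
      - ϱ / 2 * (X₀ + ∫ s, f s ∂(leb T)) ^ 2 =
    X₀ * ST - φ / 2 * T * X₀ ^ 2 - ϱ / 2 * X₀ ^ 2 +
      ((∫ t, (ST - S t) * f t ∂(leb T)) - (∫ t, I t * f t ∂(leb T)) -
        (∫ t : Time T, X₀ * (φ * (T - t) + ϱ) * f t ∂(leb T)) -
        ∫ t, f t * ∫ s in Set.Iic t, penaltyKernel T φ ϱ t s * f s ∂(leb T) ∂(leb T)) := by
  have hf1 : Integrable f (leb T) := hf.integrable (by norm_num)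
  have hV := memLp_primitive hf1
  have hV1 : Integrable (fun t : Time T => primitive f t) (leb T) := hV.integrable (by norm_num)
  have hSf : Integrable (fun t => S t * f t) (leb T) := hS.integrable_mul hf
  have hIf : Integrable (fun t => I t * f t) (leb T) := hI.integrable_mul hf
  have hTf : Integrable (fun t : Time T => (T - t) * f t) (leb T) := by
    refine hf1.bdd_mul (c := T) (by fun_prop) (.of_forall fun t => ?_)
    rw [Real.norm_of_nonneg (sub_nonneg.2 t.2.2)]
    linarith [t.2.1]
  have e1 : ∫ t, (S t + I t) * f t ∂(leb T) =
      (∫ t, S t * f t ∂(leb T)) + ∫ t, I t * f t ∂(leb T) := by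
    simp only [add_mul]
    exact integral_add hSf hIf
  -- Since `X_T S_T = X₀ S_T + ∫ S_T f`, trading cost and terminal value combine into the remaining
  -- price increment `S_T - S_t`.
  have e2 : ∫ t, (ST - S t) * f t ∂(leb T) =
      ST * (∫ t, f t ∂(leb T)) - ∫ t, S t * f t ∂(leb T) := by
    simp only [sub_mul]
    rw [integral_sub (hf1.const_mul ST) hSf, integral_const_mul]
  have e3 : ∫ t : Time T, X₀ * (φ * (T - t) + ϱ) * f t ∂(leb T) =
      X₀ * φ * (∫ t : Time T, primitive f t ∂(leb T)) + X₀ * ϱ * ∫ t, f t ∂(leb T) := by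
    rw [integral_primitive hf1, ← integral_const_mul, ← integral_const_mul,
      ← integral_add (hTf.const_mul _) (hf1.const_mul _)]
    refine integral_congr_ae (.of_forall fun t => ?_)
    simp only
    ring
  have e4 : ∫ t : Time T, (X₀ + primitive f t) ^ 2 ∂(leb T) =
      T * X₀ ^ 2 + 2 * X₀ * (∫ t : Time T, primitive f t ∂(leb T)) +
        ∫ t : Time T, primitive f t ^ 2 ∂(leb T) := by
    have h0 : ∫ _ : Time T, X₀ ^ 2 ∂(leb T) = T * X₀ ^ 2 := by
      rw [integral_const, leb_real_univ hT, smul_eq_mul]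
    have i12 : Integrable (fun t : Time T => X₀ ^ 2 + 2 * X₀ * primitive f t) (leb T) :=
      (integrable_const _).add (hV1.const_mul _)
    rw [← h0, ← integral_const_mul, ← integral_add (integrable_const _) (hV1.const_mul _),
      ← integral_add i12 hV.integrable_sq]
    refine integral_congr_ae (.of_forall fun t => ?_)
    simp only
    ring
  rw [(isAdmissible_penaltyKernel T φ ϱ).integral_mul_volterra (isCausal_penaltyKernel φ ϱ) hf hf,
    integral_penaltyKernel φ ϱ hf, e1, e2, e3, e4]
  ring

variable {Ω : Type*} {mΩ : MeasurableSpace Ω} {ℱ : Filtration (Time T) mΩ} {μ : Measure Ω}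
  {U : ℝ → ℝ} {H G : ProgL2 ℱ μ →L[ℝ] ProgL2 ℱ μ} {γ φ ϱ X₀ : ℝ} {S : Time T → Ω → ℝ}

theorem inventory_eq (u : ProgL2 ℱ μ) (t : Time T) (ω : Ω) :
    inventory X₀ u t ω = X₀ + primitive (fun s => (u : Time T × Ω → ℝ) (s, ω)) t := by
  rw [inventory, primitive_coe]

theorem inventory_terminal (hT : 0 < T) (u : ProgL2 ℱ μ) (ω : Ω) :
    inventory X₀ u (terminal hT) ω = X₀ + ∫ s, (u : Time T × Ω → ℝ) (s, ω) ∂(leb T) := by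
  rw [inventory_eq, primitive_of_ge _ (show T ≤ (terminal hT : Time T) from le_rfl)]

theorem firstOrderCondition_iff {a : ℝ} {α D : ProgL2 ℱ μ}
    (hD : (D : Time T × Ω → ℝ) =ᵐ[(leb T).prod μ] fun p => X₀ * (φ * (T - p.1) + ϱ))
    (N : ProgL2 ℱ μ →L[ℝ] ProgL2 ℱ μ) (u : ProgL2 ℱ μ) :
    FirstOrderCondition a γ φ ϱ X₀ H G N α u ↔
      γ • u + ((H + G) * Ring.inverse (1 + a • G) + N) u +
        ContinuousLinearMap.adjoint ((H + G) * Ring.inverse (1 + a • G) + N) u = α - D := by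
  have h : ((α - D : ProgL2 ℱ μ) : Time T × Ω → ℝ) =ᵐ[(leb T).prod μ]
      fun p => (α : Time T × Ω → ℝ) p - X₀ * (φ * (T - p.1) + ϱ) := by
    refine (Lp.coeFn_sub α.1 D.1).trans ?_
    filter_upwards [hD] with p hp
    rw [Pi.sub_apply, hp]
  have e : γ • u + ((H + G) * Ring.inverse (1 + a • G) + N) u +
        ContinuousLinearMap.adjoint ((H + G) * Ring.inverse (1 + a • G) + N) u =
      γ • u + ((H + G) * Ring.inverse (1 + a • G)) u
    + (Ring.inverse (1 + a • ContinuousLinearMap.adjoint G) *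
        (ContinuousLinearMap.adjoint H + ContinuousLinearMap.adjoint G)) u
    + N u + ContinuousLinearMap.adjoint N u := by
    rw [map_add, adjoint_mul_inverse, add_apply, add_apply]
    abel
  rw [e]
  exact ⟨fun h1 => progL2_ext (EventuallyEq.trans h1 h.symm), fun h1 => by
    rw [FirstOrderCondition, h1]; exact h⟩

/-- The running reward whose expected time integral is, up to a constant, the performance. -/
noncomputable def runningReward (hT : 0 < T) (U : ℝ → ℝ) (H G : ProgL2 ℱ μ →L[ℝ] ProgL2 ℱ μ)
    [SFinite μ] (γ φ ϱ : ℝ) (S : Time T → Ω → ℝ) (D u : ProgL2 ℱ μ) (p : Time T × Ω) : ℝ :=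
  (S (terminal hT) p.2 - S p.1 p.2) * (u : Time T × Ω → ℝ) p
    - (impact U H G γ u : Time T × Ω → ℝ) p * (u : Time T × Ω → ℝ) p
    - (D : Time T × Ω → ℝ) p * (u : Time T × Ω → ℝ) p
    - (u : Time T × Ω → ℝ) p * (penaltyOp ℱ μ φ ϱ u : Time T × Ω → ℝ) p

variable [IsProbabilityMeasure μ]

/-- Almost every path of a square-integrable process is in `L²(0, T)`, so `path_pnl_eq` applies for
almost every `ω`. -/
theorem pnl_ae_eq (hT : 0 < T) (hS : MemLp (Function.uncurry S) 2 ((leb T).prod μ))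
    {D : ProgL2 ℱ μ}
    (hD : (D : Time T × Ω → ℝ) =ᵐ[(leb T).prod μ] fun p => X₀ * (φ * (T - p.1) + ϱ))
    (u : ProgL2 ℱ μ) :
    pnl hT U H G γ φ ϱ X₀ S u =ᵐ[μ] fun ω =>
      X₀ * S (terminal hT) ω - φ / 2 * T * X₀ ^ 2 - ϱ / 2 * X₀ ^ 2 +
        ∫ t, runningReward hT U H G γ φ ϱ S D u (t, ω) ∂(leb T) := by
  filter_upwards [ae_memLp_path (memLp_coe u), ae_memLp_path hS,
    ae_memLp_path (memLp_coe (impact U H G γ u)), ae_memLp_path (memLp_coe D),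
    ae_memLp_path (memLp_coe (penaltyOp ℱ μ φ ϱ u)), ae_ae_path_eq hD,
    ae_ae_path_eq (coeFn_volterra (isAdmissible_penaltyKernel T φ ϱ) u)] with ω hu hS hI hd hN eD eN
  have hd : MemLp (fun t => (D : Time T × Ω → ℝ) (t, ω)) 2 (leb T) := hd
  have i1 : Integrable (fun t => (S (terminal hT) ω - S t ω) * (u : Time T × Ω → ℝ) (t, ω)) (leb T) :=
    ((memLp_const (S (terminal hT) ω)).sub hS).integrable_mul hu
  have i2 := hI.integrable_mul hu
  have i3 := hd.integrable_mul hu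
  have i4 := hu.integrable_mul hN
  have h := path_pnl_eq hT hu hS hI (S (terminal hT) ω) X₀ φ ϱ
  simp only [Function.uncurry_apply_pair] at h
  rw [pnl, inventory_terminal]
  simp only [inventory_eq]
  rw [h]
  congr 1
  have e3 : ∫ t : Time T, X₀ * (φ * (T - t) + ϱ) * (u : Time T × Ω → ℝ) (t, ω) ∂(leb T) =
      ∫ t, (D : Time T × Ω → ℝ) (t, ω) * (u : Time T × Ω → ℝ) (t, ω) ∂(leb T) := by
    refine integral_congr_ae ?_
    filter_upwards [eD] with t ht
    rw [ht]
  have e4 : ∫ t, (u : Time T × Ω → ℝ) (t, ω) * ∫ s in Set.Iic t, penaltyKernel T φ ϱ t s *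
        (u : Time T × Ω → ℝ) (s, ω) ∂(leb T) ∂(leb T) =
      ∫ t, (u : Time T × Ω → ℝ) (t, ω) * (penaltyOp ℱ μ φ ϱ u : Time T × Ω → ℝ) (t, ω)
        ∂(leb T) := by
    refine integral_congr_ae ?_
    filter_upwards [eN] with t ht
    rw [ht]
    rfl
  rw [e3, e4]
  exact (integral_sub_sub_sub i1 i2 i3 i4).symm

theorem integrable_increment_mul (hT : 0 < T) (hS : MemLp (Function.uncurry S) 2 ((leb T).prod μ))
    (hST : MemLp (S (terminal hT)) 2 μ) (u : ProgL2 ℱ μ) :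
    Integrable (fun p => (S (terminal hT) p.2 - S p.1 p.2) * (u : Time T × Ω → ℝ) p)
      ((leb T).prod μ) :=
  ((hST.comp_snd (leb T)).sub hS).integrable_mul (memLp_coe u)

theorem integrable_runningReward (hT : 0 < T)
    (hS : MemLp (Function.uncurry S) 2 ((leb T).prod μ))
    (hST : MemLp (S (terminal hT)) 2 μ) (D u : ProgL2 ℱ μ) :
    Integrable (runningReward hT U H G γ φ ϱ S D u) ((leb T).prod μ) :=
  (((integrable_increment_mul hT hS hST u).sub (integrable_mul_coe _ u)).sub
    (integrable_mul_coe D u)).sub (integrable_mul_coe u _)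

theorem integral_runningReward (hT : 0 < T)
    (hS : MemLp (Function.uncurry S) 2 ((leb T).prod μ))
    (hST : MemLp (S (terminal hT)) 2 μ) {α : ProgL2 ℱ μ} (hα : IsAlphaSignal hT S α)
    (D u : ProgL2 ℱ μ) :
    ∫ p, runningReward hT U H G γ φ ϱ S D u p ∂((leb T).prod μ) =
      inner ℝ α u - inner ℝ (impact U H G γ u) u - inner ℝ D u
        - inner ℝ u (penaltyOp ℱ μ φ ϱ u) := by
  have i1 := integrable_increment_mul hT hS hST u
  have i2 := integrable_mul_coe (impact U H G γ u) u
  have i3 := integrable_mul_coe D u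
  have i4 := integrable_mul_coe u (penaltyOp ℱ μ φ ϱ u)
  rw [← integral_increment_mul_eq_inner hT hS hST hα u, inner_eq_integral, inner_eq_integral,
    inner_eq_integral, ← integral_sub_sub_sub i1 i2 i3 i4]
  rfl

theorem performanceWellDefined (hT : 0 < T)
    (hS : MemLp (Function.uncurry S) 2 ((leb T).prod μ))
    (hST : MemLp (S (terminal hT)) 2 μ) {D : ProgL2 ℱ μ}
    (hD : (D : Time T × Ω → ℝ) =ᵐ[(leb T).prod μ] fun p => X₀ * (φ * (T - p.1) + ϱ))
    (u : ProgL2 ℱ μ) : PerformanceWellDefined hT U H G γ φ ϱ X₀ S u := by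
  refine ⟨?_, ?_⟩
  · filter_upwards [ae_memLp_path (memLp_coe u), ae_memLp_path hS,
      ae_memLp_path (memLp_coe (impact U H G γ u))] with ω hu hS hI
    have hu1 : Integrable (fun t => (u : Time T × Ω → ℝ) (t, ω)) (leb T) :=
      hu.integrable (by norm_num)
    refine ⟨hu1, (hS.add hI).integrable_mul hu, ?_⟩
    simp only [inventory_eq]
    exact ((memLp_const X₀).add (memLp_primitive hu1)).integrable_sq
  -- Products such as `X_T S_T` are not estimated one by one: the whole variable is an integrable
  -- one plus the time integral of an integrable reward.
  · refine Integrable.congr ?_ (pnl_ae_eq hT hS hD u).symm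
    refine Integrable.add ?_ (integrable_runningReward hT hS hST D u).integral_prod_right
    exact (((hST.integrable (by norm_num)).const_mul X₀).sub (integrable_const _)).sub
      (integrable_const _)

/-- The performance functional is a concave quadratic functional of the control. -/
theorem performance_eq_quadratic (hT : 0 < T)
    (hS : MemLp (Function.uncurry S) 2 ((leb T).prod μ))
    (hST : MemLp (S (terminal hT)) 2 μ) {α : ProgL2 ℱ μ} (hα : IsAlphaSignal hT S α)
    {D : ProgL2 ℱ μ}
    (hD : (D : Time T × Ω → ℝ) =ᵐ[(leb T).prod μ] fun p => X₀ * (φ * (T - p.1) + ϱ))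
    {a : ℝ} (hU : ∀ x, U x = a * x) (hG : IsUnit (1 + a • G)) :
    performance hT U H G γ φ ϱ X₀ S = quadratic
      (X₀ * (∫ ω, S (terminal hT) ω ∂μ) - φ / 2 * T * X₀ ^ 2 - ϱ / 2 * X₀ ^ 2) γ (α - D)
      ((H + G) * Ring.inverse (1 + a • G) + penaltyOp ℱ μ φ ϱ) := by
  funext u
  have hR := integrable_runningReward (U := U) (H := H) (G := G) (γ := γ) (φ := φ) (ϱ := ϱ)
    hT hS hST D u
  have hST1 : Integrable (S (terminal hT)) μ := hST.integrable (by norm_num)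
  have i1 : Integrable (fun ω => X₀ * S (terminal hT) ω - φ / 2 * T * X₀ ^ 2) μ :=
    (hST1.const_mul X₀).sub (integrable_const _)
  have i2 : Integrable (fun ω => X₀ * S (terminal hT) ω - φ / 2 * T * X₀ ^ 2 - ϱ / 2 * X₀ ^ 2) μ :=
    i1.sub (integrable_const _)
  rw [performance, integral_congr_ae (pnl_ae_eq hT hS hD u),
    integral_add i2 hR.integral_prod_right, integral_sub i1 (integrable_const _),
    integral_sub (hST1.const_mul X₀) (integrable_const _), integral_const_mul, integral_const,
    integral_const, ← integral_prod_symm _ hR, integral_runningReward hT hS hST hα, impact_eq hU hG,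
    quadratic]
  have e : inner ℝ ((γ / 2) • u) u = γ / 2 * ‖u‖ ^ 2 := by
    rw [← real_inner_self_eq_norm_sq]
    exact real_inner_smul_left u u (γ / 2)
  simp only [probReal_univ, one_smul, inner_add_left, inner_sub_left, add_apply, inner_add_right, e]
  rw [real_inner_comm u (((H + G) * Ring.inverse (1 + a • G)) u)]
  ring

end Performance

end MarketResistance

open MarketResistance
theorem mainTheorem1 {Ω : Type*} {mΩ : MeasurableSpace Ω} (μ : Measure Ω) [IsProbabilityMeasure μ]
    {T : ℝ} (hT : 0 < T) (ℱ : Filtration (Time T) mΩ)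
    -- the unaffected price `S = P + M`
    (P M : Time T → Ω → ℝ)
    (hP_prog : IsProgressive ℱ P)
    (hP_var : ∀ᵐ ω ∂μ, BoundedVariationOn (fun t => P t ω) Set.univ)
    (hP_sq : MemLp (Function.uncurry P) 2 ((leb T).prod μ))
    (hP_T : MemLp (P (terminal hT)) 2 μ)
    (hM_prog : IsProgressive ℱ M)
    (hM_mart : Martingale M ℱ μ)
    (hM_sq : ∀ t, MemLp (M t) 2 μ)
    (hM_centered : ∀ t, ∫ ω, M t ω ∂μ = 0)
    (α : ProgL2 ℱ μ) (hα : IsAlphaSignal hT (P + M) α)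
    -- the impact kernel, the resistance function and the parameters
    (g : ℝ → ℝ) (hg_cm : IsCompletelyMonotone g) (hg : IsAdmissible (convKernel T g))
    (a κ γ φ ϱ X₀ : ℝ) (ha : 0 ≤ a) (hκ : 0 ≤ κ) (hγ : 0 ≤ γ) (hφ : 0 ≤ φ) (hϱ : 0 ≤ ϱ)
    (U : ℝ → ℝ) (hU : ∀ x, U x = a * x)
    -- the transient and permanent impact operators and the performance functional
    (G H : ProgL2 ℱ μ →L[ℝ] ProgL2 ℱ μ)
    (hG : G = transientOp ℱ μ g hg) (hH : H = permanentOp ℱ μ κ)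
    (J : ProgL2 ℱ μ → ℝ) (hJ : J = performance hT U H G γ φ ϱ X₀ (P + M)) :
    (∀ u, ∃! r, IsResistance U G u r) ∧
    (∀ u, PerformanceWellDefined hT U H G γ φ ϱ X₀ (P + M) u) ∧
    IsUnit (1 + a • G) ∧
    IsUnit (1 + a • ContinuousLinearMap.adjoint G) ∧
    (∀ u, 0 ≤ inner ℝ u (((H + G) * Ring.inverse (1 + a • G)) u)) ∧
    StrongConvexOn Set.univ γ (fun u => -J u) ∧
    (∀ u, (∀ v, J v ≤ J u) ↔
      FirstOrderCondition a γ φ ϱ X₀ H G (penaltyOp ℱ μ φ ϱ) α u) ∧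
    (0 < γ →
      Tendsto (fun u => -J u) (Bornology.cobounded (ProgL2 ℱ μ)) atTop ∧
      ∃! u, ∀ v, J v ≤ J u) := by
  have hG0 : ∀ u, 0 ≤ inner ℝ u (G u) := hG ▸ inner_transientOp_nonneg hT hg_cm hg
  have hH0 : ∀ u, 0 ≤ inner ℝ u (H u) := hH ▸ inner_permanentOp_nonneg hT hκ
  have hGH0 : ∀ u, 0 ≤ inner ℝ (G u) (H u) := by
    rw [hG, hH]
    exact inner_transientOp_permanentOp_nonneg hT hg_cm hg hκ
  have hunit := isUnit_one_add_smul ha hG0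
  have hunit' : IsUnit (1 + a • ContinuousLinearMap.adjoint G) :=
    isUnit_one_add_smul ha fun u => by
      rw [ContinuousLinearMap.adjoint_inner_right, real_inner_comm]
      exact hG0 u
  have hA := inner_mul_inverse_nonneg ha hG0 hH0 hGH0
  have hB : ∀ u, 0 ≤ inner ℝ u (((H + G) * Ring.inverse (1 + a • G) + penaltyOp ℱ μ φ ϱ) u) :=
    fun u => by
      rw [add_apply, inner_add_right]
      exact add_nonneg (hA u) (inner_penaltyOp_nonneg hφ hϱ u)
  have hS : MemLp (Function.uncurry (P + M)) 2 ((leb T).prod μ) :=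
    hP_sq.add (memLp_uncurry_martingale hT hM_prog hM_mart hM_sq)
  have hST : MemLp ((P + M) (terminal hT)) 2 μ := hP_T.add (hM_sq _)
  obtain ⟨D, hD⟩ := exists_memLp_progressive (ℱ := ℱ) (μ := μ)
    (d := fun t : Time T => X₀ * (φ * (T - t) + ϱ)) (by fun_prop) (C := |X₀| * (φ * T + ϱ))
    fun t => by
      have h1 : 0 ≤ T - (t : ℝ) := sub_nonneg.2 t.2.2
      rw [abs_mul, abs_of_nonneg (show 0 ≤ φ * (T - t) + ϱ by positivity)]
      have : T - (t : ℝ) ≤ T := by linarith [t.2.1]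
      gcongr
  -- From here on only the quadratic form of `J` and `hB` matter for the optimization claims.
  rw [performance_eq_quadratic hT hS hST hα hD hU hunit] at hJ
  subst hJ
  refine ⟨existsUnique_isResistance hU hunit, performanceWellDefined hT hS hST hD, hunit, hunit',
    hA, strongConvexOn_neg_quadratic hB, fun u => ?_,
    fun hγ' => ⟨tendsto_neg_quadratic hγ' hB, existsUnique_forall_quadratic_le hγ' hB⟩⟩
  rw [forall_quadratic_le_iff hγ hB, firstOrderCondition_iff hD]
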